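/- Let $\mathbb{K}$ be a field of characteristic $0$ and let $\mathfrak{a}=(A,d,\star,1)$ be a dg left unital pre-Lie algebra over $\mathbb K$: $A=\bigoplus_{k\in\mathbb Z}A_k$ is a graded vector space, $\star$ is a bilinear product of degree $0$ with $$(x\star y)\star z-x\star(y\star z)=(-1)^{|y||z|}\big((x\star z)\star y-x\star(z\star y)\big),$$ $1\in A_0$ satisfies $1\star x=x$, and $d$ is a square-zero derivation of degree $-1$ with $d(1)=0$. Put $[x,y]=x\star y-(-1)^{|x||y|}y\star x$. Assume that there is a weight grading $A\cong\prod_{n\ge 0}A^{(n)}$ (a product in every homological degree) with $1\in A^{(0)}$, such that $\star$ is determined by its components $A^{(n)}\star A^{(m)}\subset A^{(n+m)}$, i.e. $(x\star y)_{(p)}=\sum_{n+m=p}x_{(n)}\star y_{(m)}$, and such that $d$ does not lower the weight: $d\big(\prod_{n\ge p}A^{(n)}\big)\subset\prod_{n\ge p}A^{(n)}$ for all $p$. Let $g=\prod_{n\ge1}A^{(n)}$, a dg Lie algebra. Convergence of series means that in every weight the partial sums are eventually constant. Let $\mathrm{MC}(\mathfrak g)=\{\bar\alpha\in g_{-1}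 : d\bar\alpha+\tfrac12[\bar\alpha,\bar\alpha]=0\}$, and let $\mathfrak g^+=g\oplus\mathbb K\delta$ with $|\delta|=-1$, $[\delta,x]=dx$, $[\delta,\delta]=0$, so that $\mathrm{ad}_\lambda(\delta)=-d\lambda$ for $\lambda\in g_0$. For $\lambda\in g_0$ put $e^{\lambda}=1+\sum_{n\ge1}\frac{1}{n!}(\cdots(\lambda\star\lambda)\cdots)\star\lambda$. For $a\in A$ and $b\in g_0$ put $a\circledcirc(1+b)=\sum_{n\ge0}\frac1{n!}\{a;b,\dots,b\}$ ($n$ copies of $b$), where the symmetric braces are given by $\{a;\}=a$ and $\{a;b_1,\dots,b_n\}=\{a;b_1,\dots,b_{n-1}\}\star b_n-\sum_{i<n}\{a;b_1,\dots,b_i\star b_n,\dots,b_{n-1}\}$. Let $\mathrm{BCH}(\lambda,\mu)$ denote the Baker–Campbell–Hausdorff series. Then: 1. The series $e^\lambda$, $a\circledcirc e^{\lambda}$ and $\mathrm{BCH}(\lambda,\mu)$ converge for all $\lambda,\mu\in g_0$, $a\in A$. 2. For $\lambda\in g_0$ and $\bar\alpha\in\mathrm{MC}(\mathfrak g)$,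 the differential equation $\gamma'(t)=\mathrm{ad}_\lambda(\gamma(t))$, $\gamma(0)=\delta+\bar\alpha$, has exactly one solution in formal power series in $t$ with coefficients in $\mathfrak g^+_{-1}$, namely $\gamma(t)=e^{t\,\mathrm{ad}_\lambda}(\delta+\bar\alpha)$. It converges for every $t\in\mathbb K$, in particular at $t=1$. Define $\lambda.\bar\alpha\in g_{-1}$ by $\delta+\lambda.\bar\alpha=e^{\mathrm{ad}_\lambda}(\delta+\bar\alpha)$; the value of $\gamma$ at $t$ is $\delta+(t\lambda).\bar\alpha$. 3. $\Gamma=(g_0,\mathrm{BCH},0)$ is a group, and $(\lambda,\bar\alpha)\mapsto\lambda.\bar\alpha$ is an action of $\Gamma$ on $\mathrm{MC}(\mathfrak g)$. 4. For all $\lambda\in g_0$ and $\bar\alpha\in\mathrm{MC}(\mathfrak g)$, $$\lambda.\bar\alpha=\big(e^\lambda\star\bar\alpha-d(e^\lambda)\big)\circledcirc e^{-\lambda}.$$ 5. If the differential is internal, i.e. there is $\delta\in A_{-1}$ with $[\delta,x]=dx$ for all homogeneous $x\in g$, then with $\alpha=\delta+\bar\alpha\in A$ the series $e^{\mathrm{ad}_\lambda}(\alpha)$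 converges in $A$ and $$\delta+\lambda.\bar\alpha=e^{\mathrm{ad}_\lambda}(\alpha)=(e^\lambda\star\alpha)\circledcirc e^{-\lambda}.$$ -/

import Mathlib

universe u v

open Filter

/-- A differential graded left-unital (right) pre-Lie algebra over `K`, with homological
conventions: `deg k` is the space of elements of degree `k`, and the differential has
degree `-1`. -/
structure DGPreLie (K : Type u) (A : Type v) [Field K] [AddCommGroup A] [Module K A] where
  deg : ℤ → Submodule K A
  deg_internal : DirectSum.IsInternal deg
  /-- the pre-Lie product `x ⋆ y` -/
  star : A →ₗ[K] A →ₗ[K] A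
  star_mem : ∀ {k l : ℤ} {x y : A}, x ∈ deg k → y ∈ deg l → star x y ∈ deg (k + l)
  /-- the associator is right symmetric, with the Koszul sign -/
  star_preLie : ∀ {l m : ℤ} (x : A) {y z : A}, y ∈ deg l → z ∈ deg m →
    star (star x y) z - star x (star y z) =
      (l * m).negOnePow • (star (star x z) y - star x (star z y))
  /-- the left unit -/
  one : A
  one_mem : one ∈ deg 0
  one_star : ∀ x : A, star one x = x
  /-- the differential -/
  d : A →ₗ[K] A
  d_mem : ∀ {k : ℤ} {x : A}, x ∈ deg k → d x ∈ deg (k - 1)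
  d_d : ∀ x : A, d (d x) = 0
  d_star : ∀ {k : ℤ} {x : A} (y : A), x ∈ deg k →
    d (star x y) = star (d x) y + k.negOnePow • star x (d y)
  d_one : d one = 0

namespace DGPreLie

variable {K : Type u} {A : Type v} [Field K] [AddCommGroup A] [Module K A]

/-- The graded commutator `[x, y] = x ⋆ y - (-1)^{kl} y ⋆ x` of elements `x` of degree `k`
and `y` of degree `l`. -/
def bracket (P : DGPreLie K A) (k l : ℤ) (x y : A) : A :=
  P.star x y - (k * l).negOnePow • P.star y x

/-- The right-iterated powers `l^{⋆ n} = (⋯((l ⋆ l) ⋆ l)⋯) ⋆ l`. Since `1 ⋆ l = l`, the recursion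
may start with the left unit. -/
def starPow (P : DGPreLie K A) (l : A) : ℕ → A
  | 0 => P.one
  | n + 1 => P.star (P.starPow l n) l

/-- The symmetric braces `{a; b₁, …, bₙ}`, for `b₁, …, bₙ` of degree `0` (so that no Koszul sign
occurs):
`{a; b₁, …, bₙ₊₁} = {{a; b₁, …, bₙ}; bₙ₊₁} - ∑ᵢ {a; b₁, …, {bᵢ; bₙ₊₁}, …, bₙ}`. -/
def brace (P : DGPreLie K A) : (n : ℕ) → (Fin n → A) → A → A
  | 0, _, a => a
  | n + 1, b, a =>
      P.star (P.brace n (Fin.init b) a) (b (Fin.last n)) -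
        ∑ i : Fin n, P.brace n
          (Function.update (Fin.init b) i (P.star (b i.castSucc) (b (Fin.last n)))) a

/-- The graded Lie bracket of the augmented Lie algebra `g ⊕ K δ` with `|δ| = -1`,
`[δ, x] = d x` and `[δ, δ] = 0`, on elements of degrees `k` and `l`. The pair `(x, a)` stands for
`x + a δ`; in degrees other than `-1` the second entry is `0`. -/
def bracketPlus (P : DGPreLie K A) (k l : ℤ) (x y : A × K) : A × K :=
  (P.bracket k l x.1 y.1 + x.2 • P.d y.1 - (k * l).negOnePow • (y.2 • P.d x.1), 0)

/-- The adjoint operator `ad_l = [l, -]` on the degree `-1` part of `g ⊕ K δ`, for `l` of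
degree `0`. It sends `x + a δ` to `[l, x] - a d l`. -/
def adPlus (P : DGPreLie K A) (l : A) (x : A × K) : A × K :=
  P.bracketPlus 0 (-1) (l, 0) x

/-- The iterated bracket `[a₁, [a₂, [⋯, [aₙ₋₁, aₙ]⋯]]]` of a word in degree `0` elements. -/
def nestedBracket (P : DGPreLie K A) : List A → A
  | [] => 0
  | [a] => a
  | a :: b :: w => P.bracket 0 0 a (P.nestedBracket (b :: w))

/-- The part of word length `N` of the Baker-Campbell-Hausdorff series, in Dynkin's form:
`∑_{n ≥ 1} (-1)^{n-1}/n ∑ [x^{r₁} y^{s₁} ⋯ x^{rₙ} y^{sₙ}] / (N ∏ rᵢ! sᵢ!)`, where the inner sum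
is over all `rᵢ + sᵢ > 0` with `∑ (rᵢ + sᵢ) = N`. -/
def bchTerm (P : DGPreLie K A) (x y : A) (N : ℕ) : A :=
  ∑ n ∈ Finset.Icc 1 N,
    ∑ rs ∈ (Fintype.piFinset fun _ : Fin n =>
        Finset.range (N + 1) ×ˢ Finset.range (N + 1)).filter
        (fun rs => (∀ i, 0 < (rs i).1 + (rs i).2) ∧ ∑ i, ((rs i).1 + (rs i).2) = N),
      (((-1 : K) ^ (n - 1) / (n : K)) *
        ((N : K) * ∏ i, (((rs i).1.factorial : K) * ((rs i).2.factorial : K)))⁻¹) •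
        P.nestedBracket ((List.ofFn rs).flatMap
          fun p => List.replicate p.1 x ++ List.replicate p.2 y)

/-- A weight grading `A ≅ ∏ₙ A^{(n)}` (a product of graded vector spaces, i.e. a product in
every homological degree), given by the projections `wt n` onto `A^{(n)}`. The product of `A` is
the one determined by `A^{(n)} ⋆ A^{(m)} ⊆ A^{(n + m)}`, the left unit has weight `0`, and the
differential does not lower the weight. -/
structure WeightGrading (P : DGPreLie K A) where
  wt : ℕ → A →ₗ[K] A
  wt_wt : ∀ (m n : ℕ) (x : A), wt m (wt n x) = if m = n then wt n x else 0
  wt_mem : ∀ (n : ℕ) {k : ℤ} {x : A}, x ∈ P.deg k → wt n x ∈ P.deg k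
  wt_separated : ∀ x : A, (∀ n, wt n x = 0) → x = 0
  wt_complete : ∀ (k : ℤ) (f : ℕ → A), (∀ n, f n ∈ P.deg k) → (∀ n, wt n (f n) = f n) →
    ∃ x ∈ P.deg k, ∀ n, wt n x = f n
  wt_star : ∀ (p : ℕ) (x y : A),
    wt p (P.star x y) = ∑ ij ∈ Finset.HasAntidiagonal.antidiagonal p, P.star (wt ij.1 x) (wt ij.2 y)
  wt_one : wt 0 P.one = P.one
  wt_d : ∀ (p : ℕ) (x : A), (∀ n < p, wt n x = 0) → ∀ n < p, wt n (P.d x) = 0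

namespace WeightGrading

variable {P : DGPreLie K A}

/-- `W.g k` is the degree `k` part of `g = ∏_{n ≥ 1} A^{(n)}`. -/
def g (W : P.WeightGrading) (k : ℤ) : Submodule K A :=
  P.deg k ⊓ LinearMap.ker (W.wt 0)

/-- The series `∑ f i` converges to `x`: in every weight the partial sums are eventually
equal to the component of `x`. -/
def HasWSum (W : P.WeightGrading) (f : ℕ → A) (x : A) : Prop :=
  ∀ n, ∀ᶠ N in atTop, W.wt n (∑ i ∈ Finset.range N, f i) = W.wt n x

open Classical in
/-- The sum of a convergent series (and `0` for a series that does not converge). -/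
noncomputable def wsum (W : P.WeightGrading) (f : ℕ → A) : A :=
  if h : ∃ x, W.HasWSum f x then h.choose else 0

/-- Convergence of a series in `A ⊕ K δ`. -/
def HasWSumPlus (W : P.WeightGrading) (f : ℕ → A × K) (x : A × K) : Prop :=
  W.HasWSum (fun n => (f n).1) x.1 ∧
    ∀ᶠ N in atTop, ∑ i ∈ Finset.range N, (f i).2 = x.2

/-- The terms of the pre-Lie exponential. -/
def expTerm (P : DGPreLie K A) (l : A) (n : ℕ) : A :=
  (n.factorial : K)⁻¹ • P.starPow l n

/-- The pre-Lie exponential `e^l = 1 + l + l^{⋆2}/2! + l^{⋆3}/3! + ⋯`. -/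
noncomputable def exp (W : P.WeightGrading) (l : A) : A :=
  W.wsum (expTerm P l)

/-- The terms `{a; b, …, b} / n!` of the circle product `a ⊚ u`, where `u = 1 + b`. -/
def circTerm (P : DGPreLie K A) (a u : A) (n : ℕ) : A :=
  (n.factorial : K)⁻¹ • P.brace n (fun _ => u - P.one) a

/-- The circle product `a ⊚ (1 + b) = ∑ₙ {a; b, …, b} / n!`; here `u = 1 + b`. -/
noncomputable def circ (W : P.WeightGrading) (a u : A) : A :=
  W.wsum (circTerm P a u)

/-- The Baker-Campbell-Hausdorff product on `g₀`. -/
noncomputable def bch (W : P.WeightGrading) (x y : A) : A :=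
  W.wsum (P.bchTerm x y)

/-- The Maurer-Cartan elements of the dg Lie algebra `g`. -/
def MC (W : P.WeightGrading) : Set A :=
  {α | α ∈ W.g (-1) ∧ P.d α + (2 : K)⁻¹ • P.bracket (-1) (-1) α α = 0}

/-- The formal curve `γ(t) = ∑ tⁿ γₙ` in the degree `-1` part of `g ⊕ K δ` solves the differential
equation `γ'(t) = ad_l (γ(t))` with initial value `γ(0) = δ + α`. -/
def IsIntegralCurve (W : P.WeightGrading) (l α : A) (γ : ℕ → A × K) : Prop :=
  (∀ n, (γ n).1 ∈ W.g (-1)) ∧ γ 0 = (α, 1) ∧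
    ∀ n : ℕ, ((n : K) + 1) • γ (n + 1) = P.adPlus l (γ n)

/-- The terms of the series `e^{ad_l}(δ + α)` in `g ⊕ K δ`. -/
def expAdTerm (P : DGPreLie K A) (l α : A) (n : ℕ) : A × K :=
  (n.factorial : K)⁻¹ • (P.adPlus l)^[n] (α, 1)

/-- The element `l.α` of `g` with `δ + l.α = e^{ad_l}(δ + α)`. -/
noncomputable def gauge (W : P.WeightGrading) (l α : A) : A :=
  W.wsum (fun n => (expAdTerm P l α n).1)

end WeightGrading

end DGPreLie

/-! Everything is turned into linear operators. Right multiplication `R_x : a ↦ a ⋆ x` reverses the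
bracket when one factor has degree 0: the pre-Lie identity gives `[R_l, R_x] = -R_{[l,x]}`. Hence `l
↦ -R_l` (`rho`) is a Lie representation of `g₀`, faithful because `1 ⋆ x = x`. The formal element
`δ` is represented by minus the sign-twisted differential `signedD`, which kills `1`; this extends
the commutation rule to `x + cδ` (`commutator_rightMul_rightMulPlus`). Modulo weight `p` the
operators `R_l` with `l` in `g₀` lie in a nilpotent algebra, so all exponentials are finite sums,
and separatedness of the weights recovers identities in `A` from the truncations.

In this picture `e^{ad_l}(δ + α)` is represented by conjugating the operator of `δ + α` with
`e^{-R_l}` (`exp_rho_conj_rightMulPlus`). The Maurer-Cartan equation says that this operator squares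
to zero, so conjugation preserves it. The formula for the action comes from applying the conjugated
operator to `1`: `e^{R_l}(1) = e^l`, the middle factor gives `e^l ⋆ α - d(e^l)`, and `e^{-R_l}` is
the circle product with `e^{-l}`.

Two facts carry the rest. The first is `a ⊚ e^l = e^{R_l}(a)` (`sum_sub_circ_exp_mem_fil`): over
power series in `t`, both `a ⊚ e^{tl}` and `e^{tR_l}(a)` solve `c' = c ⋆ l`, as the symmetry of the
braces shows. The second is the Baker-Campbell-Hausdorff formula in Dynkin's form for a nilpotent
associative algebra (`exp_mul_exp_eq_exp_sum_bchComm`), proved by differentiating `log(e^{tx}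
e^{ty})` with `t d/dt`. Through `rho` it makes BCH a product of operators, whence the group axioms
and the action. -/

section NilpotentEvaluation

/-! ### Exponential and logarithm series, evaluated at nilpotent elements -/

open PowerSeries

namespace PowerSeries

/-- The coefficients `1/(n+1)!` of `(e^u - 1)/u`. -/
noncomputable def expQuot : ℚ⟦X⟧ := mk fun n => ((n + 1).factorial : ℚ)⁻¹

/-- The coefficients `(-1)^n/(n+1)` of `log (1 + w)/w`. -/
noncomputable def logQuot : ℚ⟦X⟧ := mk fun n => (-1 : ℚ) ^ n / (n + 1)

theorem X_mul_expQuot : X * expQuot = exp ℚ - 1 := by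
  ext n
  cases n with
  | zero => simp
  | succ n => simp [coeff_succ_X_mul, expQuot, coeff_exp, coeff_one]

theorem X_mul_logQuot : X * logQuot = log ℚ := by
  ext n
  cases n with
  | zero => simp
  | succ n =>
    rw [coeff_succ_X_mul, logQuot, coeff_mk, coeff_log]
    simp [pow_succ]

theorem one_add_X_mul_deriv_log : (1 + X) * d⁄dX ℚ (log ℚ) = 1 := by
  rw [deriv_log]
  ext n
  cases n with
  | zero => simp [add_mul]
  | succ n => simp [add_mul, coeff_succ_X_mul, coeff_one, pow_succ]

/-- By the chain rule and `(1 + X) log' = 1`, both sides have derivative 1; neither has a constant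
term. -/
theorem log_subst_exp_sub_one : (log ℚ).subst (exp ℚ - 1) = X := by
  have hs : HasSubst (exp ℚ - 1) := HasSubst.exp_sub_one
  refine derivative.ext ?_ ?_
  · rw [derivative_subst hs, derivative_X]
    have h := congrArg (fun f => PowerSeries.subst (exp ℚ - 1) f) one_add_X_mul_deriv_log
    have h1 : PowerSeries.subst (exp ℚ - 1) (1 : ℚ⟦X⟧) = (1 : ℚ⟦X⟧) := by
      rw [← coe_substAlgHom hs, map_one]
    simp only [subst_mul hs, subst_add hs, subst_X hs, h1] at h
    rw [map_sub, derivative_exp, derivative_one, sub_zero, mul_comm]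
    simpa using h
  · have := constantCoeff_subst_eq_zero (a := (exp ℚ - 1 : ℚ⟦X⟧))
      (by rw [map_sub, map_one, ← constantCoeff_eq, constantCoeff_exp, sub_self]) (log ℚ)
      constantCoeff_log
    rw [constantCoeff_X]
    exact this

/-- With `G` the left side, `G' = G log'` and `log'' = -(log')²` make `G log'` constant, equal to 1.
Multiplying by `1 + X`, the inverse of `log'`, gives `G`. -/
theorem exp_subst_log : (exp ℚ).subst (log ℚ) = 1 + X := by
  have hs : HasSubst (log ℚ) := HasSubst.log
  set G : ℚ⟦X⟧ := (exp ℚ).subst (log ℚ) with hG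
  have hdG : d⁄dX ℚ G = G * d⁄dX ℚ (log ℚ) := by
    rw [hG, derivative_subst hs, derivative_exp]
  have h0 : constantCoeff G = 1 := by
    have h1 : G = 1 + log ℚ * (expQuot.subst (log ℚ)) := by
      have : exp ℚ = 1 + X * expQuot := by rw [X_mul_expQuot]; ring
      rw [hG]
      conv_lhs => rw [this]
      rw [subst_add hs, subst_mul hs, subst_X hs]
      congr 1
      rw [← coe_substAlgHom hs, map_one]
    rw [h1]
    simp
  have hc : constantCoeff (1 + X : ℚ⟦X⟧) ≠ 0 := by simp
  have key : G * d⁄dX ℚ (log ℚ) = 1 := by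
    refine derivative.ext ?_ ?_
    · have h2 : d⁄dX ℚ (d⁄dX ℚ (log ℚ)) = - (d⁄dX ℚ (log ℚ)) ^ 2 := by
        have h3 := congrArg (d⁄dX ℚ) one_add_X_mul_deriv_log
        rw [Derivation.leibniz, map_add, derivative_one, derivative_X, smul_eq_mul, smul_eq_mul]
          at h3
        have h4 := congrArg (fun f => d⁄dX ℚ (log ℚ) * f) h3
        simp only [mul_add, mul_zero] at h4
        have h5 := one_add_X_mul_deriv_log
        linear_combination h4 - (d⁄dX ℚ (d⁄dX ℚ (log ℚ))) * h5
      rw [Derivation.leibniz, smul_eq_mul, smul_eq_mul, h2, hdG, derivative_one]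
      ring
    · rw [map_mul, h0, deriv_log]
      simp
  calc G = G * ((1 + X) * d⁄dX ℚ (log ℚ)) := by rw [one_add_X_mul_deriv_log, mul_one]
    _ = (G * d⁄dX ℚ (log ℚ)) * (1 + X) := by ring
    _ = 1 + X := by rw [key, one_mul]

/-- Cancel `X` in `log(1 + (e^X - 1)) = X`. The point is that `(e^u - 1)/u` has an inverse that is a
series in `e^u - 1` alone. -/
theorem expQuot_mul_logQuot_subst : expQuot * logQuot.subst (exp ℚ - 1) = 1 := by
  have hs : HasSubst (exp ℚ - 1) := HasSubst.exp_sub_one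
  have h := log_subst_exp_sub_one
  rw [← X_mul_logQuot, subst_mul hs, subst_X hs, ← X_mul_expQuot, mul_assoc] at h
  rw [← X_mul_expQuot]
  exact mul_left_cancel₀ (X_ne_zero (R := ℚ)) (by rw [h, mul_one])

variable {S : Type*} [Ring S] [Algebra ℚ S]

/-- Evaluation of power series over `ℚ` at a nilpotent element of a `ℚ`-algebra. -/
noncomputable def nilEval {n : ℕ} {u : S} (hu : u ^ n = 0) : ℚ⟦X⟧ →+* S where
  toFun f := Polynomial.aeval u (trunc n f)
  map_one' := by
    cases n with
    | zero =>
      have : Subsingleton S := subsingleton_of_zero_eq_one (by simpa using hu.symm)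
      exact Subsingleton.elim _ _
    | succ n => simp [trunc_one]
  map_zero' := by simp
  map_add' f g := by simp
  map_mul' f g := by
    rw [← map_mul]
    -- Truncation is multiplicative only modulo `X ^ n`, and `u ^ n = 0` kills the difference.
    have hd : (Polynomial.X : Polynomial ℚ) ^ n ∣ trunc n (f * g) - trunc n f * trunc n g := by
      rw [Polynomial.X_pow_dvd_iff]
      intro d hd
      rw [Polynomial.coeff_sub, sub_eq_zero, coeff_trunc, if_pos hd,
        coeff_mul_eq_coeff_trunc_mul_trunc f g hd, ← Polynomial.coe_mul, Polynomial.coeff_coe]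
    obtain ⟨q, hq⟩ := hd
    have h := congrArg (Polynomial.aeval u) hq
    rw [map_sub, map_mul _ (Polynomial.X ^ n), map_pow, Polynomial.aeval_X, hu, zero_mul,
      sub_eq_zero] at h
    exact h

variable {n : ℕ} {u : S}

theorem nilEval_apply (hu : u ^ n = 0) (f : ℚ⟦X⟧) :
    nilEval hu f = ∑ i ∈ Finset.range n, coeff i f • u ^ i := by
  change Polynomial.aeval u (trunc n f) = _
  rw [Polynomial.aeval_def, eval₂_trunc_eq_sum_range]
  exact Finset.sum_congr rfl fun i _ => by rw [Algebra.smul_def]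

theorem nilEval_X (hu : u ^ n = 0) : nilEval hu X = u := by
  rw [nilEval_apply]
  rcases n with _ | _ | n
  · have : Subsingleton S := subsingleton_of_zero_eq_one (by simpa using hu.symm)
    exact Subsingleton.elim _ _
  · simp at hu
    simp [hu]
  · rw [Finset.sum_eq_single 1]
    · simp
    · intro b _ hb
      simp [coeff_X, hb]
    · simp

theorem nilEval_exp (hu : u ^ n = 0) : nilEval hu (exp ℚ) = IsNilpotent.exp u := by
  rw [nilEval_apply, IsNilpotent.exp_eq_sum hu]
  exact Finset.sum_congr rfl fun i _ => by simp [coeff_exp]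

theorem exists_eq_trunc_add (n : ℕ) (f : ℚ⟦X⟧) :
    ∃ g : ℚ⟦X⟧, f = ((trunc n f : Polynomial ℚ) : ℚ⟦X⟧) + X ^ n * g := by
  have : X ^ n ∣ f - ((trunc n f : Polynomial ℚ) : ℚ⟦X⟧) := by
    rw [X_pow_dvd_iff]
    intro m hm
    rw [map_sub, Polynomial.coeff_coe, coeff_trunc, if_pos hm, sub_self]
  obtain ⟨g, hg⟩ := this
  exact ⟨g, by rw [← hg]; ring⟩

/-- Split `f` into its truncation and a multiple of `X ^ m`. The latter dies, and for polynomials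
substitution commutes with any ring homomorphism. -/
theorem nilEval_subst (hu : u ^ n = 0) {w : ℚ⟦X⟧} (hw : HasSubst w) {m : ℕ}
    (hm : nilEval hu w ^ m = 0) (f : ℚ⟦X⟧) :
    nilEval hu (f.subst w) = nilEval hm f := by
  obtain ⟨g, hg⟩ := exists_eq_trunc_add m f
  conv_lhs => rw [hg, subst_add hw, subst_mul hw, subst_pow hw, subst_X hw, subst_coe hw]
  rw [map_add, map_mul, map_pow, hm, zero_mul, add_zero]
  change _ = Polynomial.aeval _ _
  induction trunc m f using Polynomial.induction_on' with
  | add p q hp hq => simp [hp, hq]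
  | monomial k a =>
    rw [Polynomial.aeval_monomial, Polynomial.aeval_monomial, map_mul, map_pow]
    congr 1
    exact RingHom.congr_fun (RingHom.ext_rat ((nilEval hu).comp (algebraMap ℚ ℚ⟦X⟧))
      (algebraMap ℚ S)) a

theorem map_nilEval {T : Type*} [Ring T] [Algebra ℚ T] (φ : S →+* T) (hu : u ^ n = 0)
    (hv : φ u ^ n = 0) (f : ℚ⟦X⟧) : φ (nilEval hu f) = nilEval hv f := by
  rw [nilEval_apply, nilEval_apply, map_sum]
  exact Finset.sum_congr rfl fun i _ => by rw [map_rat_smul, map_pow]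

theorem nilEval_pow_eq_zero (hu : u ^ n = 0) {w : ℚ⟦X⟧} (hw : constantCoeff w = 0) :
    nilEval hu w ^ n = 0 := by
  obtain ⟨g, rfl⟩ := X_dvd_iff.mpr hw
  rw [← map_pow, mul_pow, map_mul, map_pow, nilEval_X, hu, zero_mul]

/-- The logarithm of a unipotent element. -/
theorem exp_nilEval_log (hu : u ^ n = 0) : IsNilpotent.exp (nilEval hu (log ℚ)) = 1 + u := by
  have h := nilEval_pow_eq_zero hu (constantCoeff_log (A := ℚ))
  rw [← nilEval_exp h, ← nilEval_subst hu HasSubst.log h, exp_subst_log, map_add, map_one,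
    nilEval_X]

theorem nilEval_logQuot_mul_expQuot (hu : u ^ n = 0) {m : ℕ}
    (hm : (IsNilpotent.exp u - 1) ^ m = 0) :
    nilEval hm logQuot * nilEval hu expQuot = 1 := by
  have he : nilEval hu (exp ℚ - 1) = IsNilpotent.exp u - 1 := by
    rw [map_sub, map_one, nilEval_exp]
  have hm' : nilEval hu (exp ℚ - 1) ^ m = 0 := by rw [he, hm]
  have h := congrArg (nilEval hu) expQuot_mul_logQuot_subst
  rw [mul_comm, map_mul, map_one, nilEval_subst hu HasSubst.exp_sub_one hm'] at h
  refine Eq.trans ?_ h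
  congr 1
  -- The two evaluations are at equal but syntactically different elements, so they are compared as
  -- explicit sums.
  simp only [nilEval_apply, he]

end PowerSeries

end NilpotentEvaluation

/-! ### Exponentials of commutator operators -/

section Conjugation

variable {S : Type*} [Ring S] [Algebra ℚ S]

/-- The commutator `x ↦ z x - x z` as a linear operator. -/
def commOp (z : S) : Module.End ℚ S := LinearMap.mulLeft ℚ z - LinearMap.mulRight ℚ z

theorem commOp_apply (z x : S) : commOp z x = z * x - x * z := rfl

theorem isNilpotent_commOp {z : S} (hz : IsNilpotent z) : IsNilpotent (commOp z) :=
  (LinearMap.commute_mulLeft_right z z).isNilpotent_sub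
    ((LinearMap.isNilpotent_mulLeft_iff (R := ℚ) z).mpr hz)
    ((LinearMap.isNilpotent_mulRight_iff (R := ℚ) z).mpr hz)

theorem exp_mulLeft {z : S} (hz : IsNilpotent z) :
    IsNilpotent.exp (LinearMap.mulLeft ℚ z) = LinearMap.mulLeft ℚ (IsNilpotent.exp z) := by
  obtain ⟨n, hn⟩ := hz
  have h : LinearMap.mulLeft ℚ z ^ n = 0 := by rw [LinearMap.pow_mulLeft, hn]; simp
  rw [IsNilpotent.exp_eq_sum h, IsNilpotent.exp_eq_sum hn]
  ext x
  simp [LinearMap.pow_mulLeft, Finset.sum_mul]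

theorem exp_mulRight {z : S} (hz : IsNilpotent z) :
    IsNilpotent.exp (LinearMap.mulRight ℚ z) = LinearMap.mulRight ℚ (IsNilpotent.exp z) := by
  obtain ⟨n, hn⟩ := hz
  have h : LinearMap.mulRight ℚ z ^ n = 0 := by rw [LinearMap.pow_mulRight, hn]; simp
  rw [IsNilpotent.exp_eq_sum h, IsNilpotent.exp_eq_sum hn]
  ext x
  simp [LinearMap.pow_mulRight, Finset.mul_sum]

/-- Left and right multiplication by `z` commute, so the exponential of their difference factors. -/
theorem exp_commOp_apply {z : S} (hz : IsNilpotent z) (x : S) :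
    IsNilpotent.exp (commOp z) x = IsNilpotent.exp z * x * IsNilpotent.exp (-z) := by
  have hneg : -LinearMap.mulRight ℚ z = LinearMap.mulRight ℚ (-z) := by ext; simp
  rw [commOp, sub_eq_add_neg, hneg, IsNilpotent.exp_add_of_commute
    (LinearMap.commute_mulLeft_right z (-z))
    ((LinearMap.isNilpotent_mulLeft_iff (R := ℚ) z).mpr hz)
    ((LinearMap.isNilpotent_mulRight_iff (R := ℚ) (-z)).mpr hz.neg), exp_mulLeft hz,
    exp_mulRight hz.neg]
  simp [mul_assoc]

-- From `e^u = 1 + ((e^u - 1)/u) u`. Isolating `[z, x]` is what later allows solving for it.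
open PowerSeries in
theorem exp_commOp_apply_eq_add {z : S} {n : ℕ} (hn : commOp z ^ n = 0) (x : S) :
    IsNilpotent.exp (commOp z) x = x + nilEval hn expQuot (commOp z x) := by
  have h : exp ℚ = 1 + expQuot * X := by rw [mul_comm, X_mul_expQuot]; ring
  rw [← nilEval_exp hn, h, map_add, map_mul, map_one, nilEval_X]
  simp

end Conjugation

/-! ### Dynkin's sums of iterated commutators -/

section NestedCommutators

/-- The iterated commutator `[a₁, [a₂, [⋯, aₙ]⋯]]` of a word in a ring. -/
def nestedComm {S : Type*} [Ring S] : List S → S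
  | [] => 0
  | [a] => a
  | a :: b :: w => a * nestedComm (b :: w) - nestedComm (b :: w) * a

theorem nestedComm_cons {S : Type*} [Ring S] (a : S) {w : List S} (hw : w ≠ []) :
    nestedComm (a :: w) = a * nestedComm w - nestedComm w * a := by
  cases w with
  | nil => exact absurd rfl hw
  | cons b w => rfl

theorem map_nestedComm {S T : Type*} [Ring S] [Ring T] (f : S →+* T) (w : List S) :
    f (nestedComm w) = nestedComm (w.map f) := by
  induction w with
  | nil => simp [nestedComm]
  | cons a w ih =>
    rcases eq_or_ne w [] with rfl | hw
    · simp [nestedComm]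
    · rw [nestedComm_cons a hw, List.map_cons, nestedComm_cons _ (by simpa using hw), ← ih]
      simp

variable {S : Type*} [Ring S] [Algebra ℚ S]

theorem nestedComm_replicate_append (a : S) (r : ℕ) {w : List S} (hw : w ≠ []) :
    nestedComm (List.replicate r a ++ w) = (commOp a ^ r) (nestedComm w) := by
  induction r with
  | zero => simp
  | succ r ih =>
    rw [List.replicate_succ, List.cons_append, nestedComm_cons a (by simp [hw]), ih, pow_succ']
    rfl

/-- The word `x^r y^s`. -/
def bchBlock {T : Type*} (x y : T) (p : ℕ × ℕ) : List T := List.replicate p.1 x ++ List.replicate p.2 y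

theorem nestedComm_bchBlock_append (x y : S) (p : ℕ × ℕ) {w : List S} (hw : w ≠ []) :
    nestedComm (bchBlock x y p ++ w) = (commOp x ^ p.1 * commOp y ^ p.2) (nestedComm w) := by
  rw [bchBlock, List.append_assoc, nestedComm_replicate_append _ _ (by simp [hw]),
    nestedComm_replicate_append _ _ hw]
  rfl

theorem nestedComm_replicate (a : S) (r : ℕ) :
    nestedComm (List.replicate r a) = if r = 1 then a else 0 := by
  rcases r with _ | _ | r
  · simp [nestedComm]
  · simp [nestedComm]
  · rw [if_neg (by omega)]
    have : List.replicate (r + 1 + 1) a = List.replicate (r + 1) a ++ [a] := by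
      rw [← List.replicate_succ']
    rw [this, nestedComm_replicate_append _ _ (by simp), pow_succ]
    simp [nestedComm, commOp_apply]

/-- Since `[x, x] = [y, y] = 0`, an innermost block survives only if it ends in exactly one `y`, or
is the single letter `x`. -/
theorem nestedComm_bchBlock (x y : S) (p : ℕ × ℕ) :
    nestedComm (bchBlock x y p) =
      (if p.2 = 1 then (commOp x ^ p.1) y else 0) + (if p = (1, 0) then x else 0) := by
  obtain ⟨r, s⟩ := p
  rcases Nat.eq_zero_or_pos s with rfl | hs
  · simp [bchBlock, nestedComm_replicate]
  · rw [bchBlock, nestedComm_replicate_append _ _ (by simp; omega), nestedComm_replicate]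
    have : ¬ ((r, s) = (1, 0)) := by simp; omega
    rw [if_neg this, add_zero]
    split <;> simp

/-- The exponents `(r, s)` with `r, s < m`, `r + s > 0`. -/
def bchIndex (m : ℕ) : Finset (ℕ × ℕ) :=
  (Finset.range m ×ˢ Finset.range m).filter fun p => 0 < p.1 + p.2

/-- The coefficient `1/(r! s!)`. -/
def bchWeight (p : ℕ × ℕ) : ℚ := ((p.1.factorial : ℚ) * (p.2.factorial : ℚ))⁻¹

theorem sum_bchIndex {M : Type*} [AddCommGroup M] (m : ℕ) (f : ℕ × ℕ → M) :
    ∑ p ∈ bchIndex (m + 1), f p =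
      ∑ p ∈ Finset.range (m + 1) ×ˢ Finset.range (m + 1), f p - f (0, 0) := by
  rw [eq_sub_iff_add_eq, ← Finset.sum_filter_add_sum_filter_not
    (Finset.range (m + 1) ×ˢ Finset.range (m + 1)) (fun p => 0 < p.1 + p.2)]
  congr 1
  have : (Finset.range (m + 1) ×ˢ Finset.range (m + 1)).filter
      (fun p => ¬ 0 < p.1 + p.2) = {(0, 0)} := by
    ext ⟨a, b⟩
    simp
    omega
  rw [this, Finset.sum_singleton]

/-- The surviving blocks `x^r y` add up to the exponential series applied to `y`. The bound `m + 2`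
ensures that the exponent 1 is in range. -/
theorem sum_bchWeight_nestedComm_bchBlock {x y : S} {m : ℕ} (hx : commOp x ^ (m + 2) = 0) :
    ∑ p ∈ bchIndex (m + 2), bchWeight p • nestedComm (bchBlock x y p) =
      x + IsNilpotent.exp (commOp x) y := by
  rw [sum_bchIndex, IsNilpotent.exp_eq_sum hx]
  have h0 : nestedComm (bchBlock x y (0, 0)) = 0 := rfl
  rw [h0, smul_zero, sub_zero]
  simp only [nestedComm_bchBlock, smul_add, Finset.sum_add_distrib]
  rw [add_comm]
  congr 1
  · rw [Finset.sum_eq_single (1, 0)]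
    · simp [bchWeight]
    · intro p _ hp
      simp [hp]
    · simp
  · rw [Finset.sum_product, LinearMap.sum_apply]
    refine Finset.sum_congr rfl fun r _ => ?_
    rw [Finset.sum_eq_single 1]
    · simp [bchWeight]
    · intro p _ hp
      simp [hp]
    · simp

theorem sum_bchWeight_commOp {x y : S} {m : ℕ} (hx : commOp x ^ (m + 1) = 0)
    (hy : commOp y ^ (m + 1) = 0) :
    ∑ p ∈ bchIndex (m + 1), bchWeight p • (commOp x ^ p.1 * commOp y ^ p.2) =
      IsNilpotent.exp (commOp x) * IsNilpotent.exp (commOp y) - 1 := by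
  rw [sum_bchIndex, IsNilpotent.exp_eq_sum hx, IsNilpotent.exp_eq_sum hy, Finset.sum_product,
    Finset.sum_mul_sum]
  congr 1
  · refine Finset.sum_congr rfl fun r _ => Finset.sum_congr rfl fun s _ => ?_
    simp only [bchWeight]
    rw [smul_mul_smul_comm, mul_inv]
  · simp [bchWeight]

theorem sum_piFinset_cons {ι M : Type*} [AddCommMonoid M] [DecidableEq ι] (n : ℕ) (B : Finset ι)
    (f : (Fin (n + 1) → ι) → M) :
    ∑ rs ∈ Fintype.piFinset (fun _ : Fin (n + 1) => B), f rs =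
      ∑ a ∈ B, ∑ rs ∈ Fintype.piFinset (fun _ : Fin n => B), f (Fin.cons a rs) := by
  rw [← Finset.sum_product']
  refine Finset.sum_nbij' (fun rs => (rs 0, Fin.tail rs)) (fun p => Fin.cons p.1 p.2) ?_ ?_ ?_ ?_ ?_
  · intro rs h
    simp only [Fintype.mem_piFinset, Finset.mem_product] at h ⊢
    exact ⟨h 0, fun i => h i.succ⟩
  · intro p h
    simp only [Fintype.mem_piFinset, Finset.mem_product] at h ⊢
    intro i
    cases i using Fin.cases with
    | zero => exact h.1
    | succ i => exact h.2 i
  · intro rs _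
    simp
  · intro p _
    simp
  · intro rs _
    simp

/-- The word `x^{r₁} y^{s₁} ⋯ x^{rₙ} y^{sₙ}`. -/
def bchWord {T : Type*} (x y : T) {n : ℕ} (rs : Fin n → ℕ × ℕ) : List T :=
  (List.ofFn rs).flatMap (bchBlock x y)

theorem bchWord_cons {T : Type*} (x y : T) {n : ℕ} (p : ℕ × ℕ) (rs : Fin n → ℕ × ℕ) :
    bchWord x y (Fin.cons p rs : Fin (n + 1) → ℕ × ℕ) = bchBlock x y p ++ bchWord x y rs := by
  simp [bchWord, List.ofFn_succ]

theorem length_bchWord {T : Type*} (x y : T) {n : ℕ} (rs : Fin n → ℕ × ℕ) :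
    (bchWord x y rs).length = ∑ i, ((rs i).1 + (rs i).2) := by
  induction n with
  | zero => simp [bchWord]
  | succ n ih =>
    rw [← Fin.cons_self_tail rs, bchWord_cons, List.length_append, ih, Fin.sum_univ_succ]
    simp [bchBlock]

theorem mem_bchWord {T : Type*} {x y : T} {n : ℕ} {rs : Fin n → ℕ × ℕ} {a : T} (h : a ∈ bchWord x y rs) :
    a = x ∨ a = y := by
  simp only [bchWord, List.mem_flatMap, bchBlock, List.mem_append, List.mem_replicate] at h
  obtain ⟨p, -, h | h⟩ := h
  · exact Or.inl h.2
  · exact Or.inr h.2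

/-- The last block supplies the vector; every block before it acts as an operator, and summing over
its exponents gives one factor `e^{ad x} e^{ad y} - 1`. The `-1` accounts for the excluded empty
block. -/
theorem sum_nestedComm_bchWord {x y : S} {m : ℕ} (hx : commOp x ^ (m + 2) = 0)
    (hy : commOp y ^ (m + 2) = 0) (n : ℕ) :
    ∑ rs ∈ Fintype.piFinset (fun _ : Fin (n + 1) => bchIndex (m + 2)),
        (∏ i, bchWeight (rs i)) • nestedComm (bchWord x y rs) =
      ((IsNilpotent.exp (commOp x) * IsNilpotent.exp (commOp y) - 1) ^ n)
        (x + IsNilpotent.exp (commOp x) y) := by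
  induction n with
  | zero =>
    rw [sum_piFinset_cons, ← sum_bchWeight_nestedComm_bchBlock hx]
    refine Finset.sum_congr rfl fun p _ => ?_
    simp [bchWord]
  | succ n ih =>
    rw [sum_piFinset_cons, pow_succ', Module.End.mul_apply, ← ih, ← sum_bchWeight_commOp hx hy,
      LinearMap.sum_apply]
    refine Finset.sum_congr rfl fun p _ => ?_
    rw [LinearMap.smul_apply, map_sum, Finset.smul_sum]
    refine Finset.sum_congr rfl fun rs hrs => ?_
    -- The operator form of a prefix fails for an empty rest, whose commutator is 0 by convention;
    -- here the first remaining block has positive length.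
    have hne : bchWord x y rs ≠ [] := by
      intro h0
      have h1 := length_bchWord x y rs
      rw [h0, List.length_nil, Fin.sum_univ_succ] at h1
      have h2 := Fintype.mem_piFinset.mp hrs 0
      simp only [bchIndex, Finset.mem_filter] at h2
      omega
    rw [bchWord_cons, nestedComm_bchBlock_append x y p hne, map_smul, smul_smul,
      Fin.prod_univ_succ]
    simp

/-- The component of word length `N` of the Baker-Campbell-Hausdorff series in a ring. -/
def bchComm (x y : S) (N : ℕ) : S :=
  ∑ n ∈ Finset.Icc 1 N,
    ∑ rs ∈ (Fintype.piFinset fun _ : Fin n =>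
        Finset.range (N + 1) ×ˢ Finset.range (N + 1)).filter
        (fun rs => (∀ i, 0 < (rs i).1 + (rs i).2) ∧ ∑ i, ((rs i).1 + (rs i).2) = N),
      (((-1 : ℚ) ^ (n - 1) / (n : ℚ)) *
        ((N : ℚ) * ∏ i, (((rs i).1.factorial : ℚ) * ((rs i).2.factorial : ℚ)))⁻¹) •
        nestedComm (bchWord x y rs)

/-- The factor `N` cancels Dynkin's `1/N`. The index ranges are made independent of `N` in order to
sum over `N` afterwards; the added numbers of blocks contribute nothing because `n` nonempty blocks
have length at least `n`. -/
theorem natCast_smul_bchComm (x y : S) {N m : ℕ} (hN : N < m) :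
    (N : ℚ) • bchComm x y N = ∑ n ∈ Finset.range m,
      ∑ rs ∈ (Fintype.piFinset fun _ : Fin (n + 1) => bchIndex m).filter
        (fun rs => ∑ i, ((rs i).1 + (rs i).2) = N),
      ((-1 : ℚ) ^ n / ((n : ℚ) + 1)) •
        (∏ i, bchWeight (rs i)) • nestedComm (bchWord x y rs) := by
  have hpos : ∀ (n : ℕ) (rs : Fin n → ℕ × ℕ), (∀ i, 0 < (rs i).1 + (rs i).2) →
      n ≤ ∑ i, ((rs i).1 + (rs i).2) := by
    intro n rs h
    calc n = ∑ _i : Fin n, 1 := by simp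
      _ ≤ _ := Finset.sum_le_sum fun i _ => h i
  have hset : ∀ n : ℕ, (Fintype.piFinset fun _ : Fin n => bchIndex m).filter
        (fun rs => ∑ i, ((rs i).1 + (rs i).2) = N) =
      (Fintype.piFinset fun _ : Fin n =>
        Finset.range (N + 1) ×ˢ Finset.range (N + 1)).filter
        (fun rs => (∀ i, 0 < (rs i).1 + (rs i).2) ∧ ∑ i, ((rs i).1 + (rs i).2) = N) := by
    intro n
    ext rs
    simp only [Finset.mem_filter, Fintype.mem_piFinset, bchIndex, Finset.mem_product,
      Finset.mem_range]
    constructor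
    · rintro ⟨h, hs⟩
      refine ⟨fun i => ?_, fun i => (h i).2, hs⟩
      have := Finset.single_le_sum (f := fun i => (rs i).1 + (rs i).2) (fun _ _ => Nat.zero_le _)
        (Finset.mem_univ i)
      have hi := h i
      omega
    · rintro ⟨h, h', hs⟩
      exact ⟨fun i => ⟨by have := h i; omega, h' i⟩, hs⟩
  have hsub : Finset.Icc 1 N ⊆ Finset.Icc 1 m := Finset.Icc_subset_Icc_right hN.le
  rw [bchComm, Finset.sum_subset hsub, Finset.smul_sum, ← Finset.Ico_add_one_right_eq_Icc,
    Finset.sum_Ico_eq_sum_range]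
  · refine Finset.sum_congr (by simp) fun n _ => ?_
    rw [Finset.smul_sum, add_comm 1 n, ← hset]
    refine Finset.sum_congr rfl fun rs hrs => ?_
    have hN0 : (N : ℚ) ≠ 0 := by
      rw [hset, Finset.mem_filter] at hrs
      have := hpos _ rs hrs.2.1
      rw [hrs.2.2] at this
      exact Nat.cast_ne_zero.mpr (by omega)
    rw [smul_smul, smul_smul]
    congr 1
    simp only [bchWeight, Finset.prod_inv_distrib, Nat.add_sub_cancel]
    push_cast
    field_simp
  · intro n hn hn'
    refine Finset.sum_eq_zero fun rs hrs => ?_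
    rw [Finset.mem_filter] at hrs
    have := hpos _ rs hrs.2.1
    simp only [Finset.mem_Icc] at hn hn'
    omega

/-- Summing over all `N` removes the length constraint, since longer words vanish by `hw`. What is
left is the series of `log(1 + w)/w` at `w = e^{ad x} e^{ad y} - 1`. -/
theorem sum_natCast_smul_bchComm {x y : S} {m : ℕ} (hx : commOp x ^ (m + 2) = 0)
    (hy : commOp y ^ (m + 2) = 0)
    (hw : ∀ w : List S, (∀ a ∈ w, a = x ∨ a = y) → m + 2 ≤ w.length → nestedComm w = 0)
    {k : ℕ} (hk : (IsNilpotent.exp (commOp x) * IsNilpotent.exp (commOp y) - 1) ^ k = 0)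
    (hkm : k ≤ m + 2) :
    ∑ N ∈ Finset.range (m + 2), (N : ℚ) • bchComm x y N =
      PowerSeries.nilEval hk PowerSeries.logQuot (x + IsNilpotent.exp (commOp x) y) := by
  have hk' : (IsNilpotent.exp (commOp x) * IsNilpotent.exp (commOp y) - 1) ^ (m + 2) = 0 :=
    pow_eq_zero_of_le hkm hk
  have heq : PowerSeries.nilEval hk PowerSeries.logQuot =
      PowerSeries.nilEval hk' PowerSeries.logQuot := by
    rw [PowerSeries.nilEval_apply, PowerSeries.nilEval_apply]
    refine Finset.sum_subset (Finset.range_subset_range.mpr hkm) fun i _ hi => ?_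
    rw [pow_eq_zero_of_le (by simpa using hi) hk, smul_zero]
  rw [heq, PowerSeries.nilEval_apply, LinearMap.sum_apply,
    Finset.sum_congr rfl fun N hN => natCast_smul_bchComm x y (Finset.mem_range.mp hN),
    Finset.sum_comm]
  refine Finset.sum_congr rfl fun n _ => ?_
  rw [LinearMap.smul_apply, ← sum_nestedComm_bchWord hx hy, PowerSeries.logQuot,
    PowerSeries.coeff_mk, Finset.smul_sum]
  simp only [Finset.sum_filter]
  rw [Finset.sum_comm]
  refine Finset.sum_congr rfl fun rs _ => ?_
  -- For fixed exponents only `N` equal to the word length contributes.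
  rw [Finset.sum_ite_eq]
  split
  · rfl
  · rename_i h
    rw [hw (bchWord x y rs) (fun a ha => mem_bchWord ha)
      (by rw [length_bchWord]; simpa using h), smul_zero, smul_zero]

end NestedCommutators

/-! ### A derivation applied to the logarithm of a product of exponentials -/

section DerivationFormula

open PowerSeries

variable {S : Type*} [Ring S] [Algebra ℚ S]

theorem nilEval_apply_of_apply_eq_zero {M : Type*} [AddCommGroup M] [Module ℚ M]
    {T : Module.End ℚ M} {n : ℕ} (hn : T ^ n = 0) (f : ℚ⟦X⟧) {v : M} (hv : T v = 0) :
    nilEval hn f v = constantCoeff f • v := by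
  have hf : f = C (constantCoeff f) + (mk fun p => coeff (p + 1) f) * X := by
    conv_lhs => rw [eq_shift_mul_X_add_const f]
    rw [add_comm]
  have hC : nilEval hn (C (constantCoeff f)) = algebraMap ℚ _ (constantCoeff f) :=
    RingHom.congr_fun (RingHom.ext_rat ((nilEval hn).comp (C (R := ℚ)))
      (algebraMap ℚ (Module.End ℚ M))) _
  conv_lhs => rw [hf]
  rw [map_add, map_mul, nilEval_X, hC]
  simp [hv]

/-- The series stops after the linear term, as `(e^u - 1)/u` has constant term 1. -/
theorem exp_commOp_apply_of_commute {z x y : S} (hz : IsNilpotent z) (h : commOp z x = y)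
    (hy : commOp z y = 0) : IsNilpotent.exp (commOp z) x = x + y := by
  obtain ⟨n, hn⟩ := isNilpotent_commOp hz
  rw [exp_commOp_apply_eq_add hn, h, nilEval_apply_of_apply_eq_zero hn _ hy]
  simp [expQuot]

/-- If `D` acts on `x` and `y` as the number derivation then it acts on `log (eˣ eʸ)` as on the
Baker-Campbell-Hausdorff series. -/
theorem commutator_log_exp_mul_exp {x y D u : S} (hx : IsNilpotent x) (hy : IsNilpotent y)
    (hDx : D * x - x * D = x) (hDy : D * y - y * D = y)
    {k : ℕ} (hu : u ^ k = 0) (hxy : IsNilpotent.exp x * IsNilpotent.exp y = 1 + u)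
    {m : ℕ} (hw : ∀ w : List S, (∀ a ∈ w, a = x ∨ a = y) → m ≤ w.length → nestedComm w = 0) :
    ∃ m', m ≤ m' ∧ D * nilEval hu (log ℚ) - nilEval hu (log ℚ) * D =
      ∑ N ∈ Finset.range m', (N : ℚ) • bchComm x y N := by
  set z := nilEval hu (log ℚ) with hz
  have hznil : IsNilpotent z := ⟨k, nilEval_pow_eq_zero hu (constantCoeff_log (A := ℚ))⟩
  have hez : IsNilpotent.exp z = IsNilpotent.exp x * IsNilpotent.exp y := by
    rw [hz, exp_nilEval_log, hxy]
  have hez' : IsNilpotent.exp (-z) = IsNilpotent.exp (-y) * IsNilpotent.exp (-x) := by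
    have h1 : IsNilpotent.exp (-y) * IsNilpotent.exp (-x) * IsNilpotent.exp z = 1 := by
      rw [hez, mul_assoc, ← mul_assoc (IsNilpotent.exp (-x)),
        IsNilpotent.exp_neg_mul_exp_self hx, one_mul, IsNilpotent.exp_neg_mul_exp_self hy]
    exact (left_inv_eq_right_inv h1 (IsNilpotent.exp_mul_exp_neg_self hznil)).symm
  -- Conjugation by `e^z = e^x e^y` is the composite of the two conjugations.
  have hcomp : IsNilpotent.exp (commOp z) =
      IsNilpotent.exp (commOp x) * IsNilpotent.exp (commOp y) := by
    ext s
    rw [Module.End.mul_apply, exp_commOp_apply hznil, exp_commOp_apply hx, exp_commOp_apply hy,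
      hez, hez']
    simp only [mul_assoc]
  obtain ⟨n, hn⟩ := isNilpotent_commOp hznil
  -- Apply both sides of `hcomp` to `D`. The right one gives `D - x - e^{ad x} y`, the left one `D`
  -- minus `(e^u - 1)/u`, with `u = ad z`, applied to `[D, z]`.
  have hφ : nilEval hn expQuot (D * z - z * D) = x + IsNilpotent.exp (commOp x) y := by
    have h1 := exp_commOp_apply_eq_add hn D
    have h2 : IsNilpotent.exp (commOp y) D = D + -y :=
      exp_commOp_apply_of_commute hy (by rw [commOp_apply, ← neg_sub, hDy])
        (by simp [commOp_apply])
    have h3 : IsNilpotent.exp (commOp x) D = D + -x :=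
      exp_commOp_apply_of_commute hx (by rw [commOp_apply, ← neg_sub, hDx])
        (by simp [commOp_apply])
    have h4 : commOp z D = -(D * z - z * D) := by rw [commOp_apply, neg_sub]
    rw [hcomp, Module.End.mul_apply, h2, map_add, h3, map_neg, h4, map_neg, add_assoc] at h1
    have h5 := add_left_cancel h1
    rw [← neg_add] at h5
    exact (neg_injective h5).symm
  obtain ⟨q, hq⟩ := IsNilpotent.isNilpotent_exp_sub_one (isNilpotent_commOp hznil)
  -- Inverting `(e^u - 1)/u` by `log(1 + w)/w` at `w = e^u - 1` solves for `[D, z]`.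
  have hψ := congrArg (fun T : Module.End ℚ S => T (D * z - z * D))
    (nilEval_logQuot_mul_expQuot hn hq)
  simp only [Module.End.mul_apply, Module.End.one_apply, hφ] at hψ
  obtain ⟨a, ha⟩ := isNilpotent_commOp hx
  obtain ⟨b, hb⟩ := isNilpotent_commOp hy
  have hq' : (IsNilpotent.exp (commOp x) * IsNilpotent.exp (commOp y) - 1) ^ q = 0 := by
    rw [← hcomp, hq]
  -- One bound that exceeds the word length and all nilpotency exponents involved.
  refine ⟨m + a + b + q + 2, by omega, ?_⟩
  rw [sum_natCast_smul_bchComm (m := m + a + b + q) (pow_eq_zero_of_le (by omega) ha)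
    (pow_eq_zero_of_le (by omega) hb) (fun w hw' hlen => hw w hw' (by omega)) hq' (by omega),
    ← hψ]
  congr 1
  simp only [nilEval_apply, hcomp]

theorem map_bchWord {T T' : Type*} (f : T → T') (x y : T) {n : ℕ} (rs : Fin n → ℕ × ℕ) :
    (bchWord x y rs).map f = bchWord (f x) (f y) rs := by
  rw [bchWord, bchWord, List.map_flatMap]
  congr 1
  ext1 p
  simp [bchBlock]

theorem map_bchComm {T : Type*} [Ring T] [Algebra ℚ T] (f : S →+* T) (x y : S) (N : ℕ) :
    f (bchComm x y N) = bchComm (f x) (f y) N := by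
  simp only [bchComm, map_sum, map_rat_smul, map_nestedComm, map_bchWord]

theorem nestedComm_mem_pow {J : Submodule ℚ S} (w : List S) (hw : ∀ a ∈ w, a ∈ J) :
    nestedComm w ∈ J ^ w.length := by
  induction w with
  | nil => simp [nestedComm]
  | cons a w ih =>
    rcases eq_or_ne w [] with rfl | hne
    · simpa [nestedComm] using hw
    · rw [nestedComm_cons a hne, List.length_cons]
      have ha := hw a (by simp)
      have h1 := ih fun b hb => hw b (by simp [hb])
      refine Submodule.sub_mem _ ?_ ?_
      · rw [pow_succ']; exact Submodule.mul_mem_mul ha h1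
      · rw [pow_succ]; exact Submodule.mul_mem_mul h1 ha

theorem nestedComm_eq_zero_of_pow_eq_bot {J : Submodule ℚ S} {p : ℕ}
    (hp : J ^ p = ⊥) (w : List S) (hw : ∀ a ∈ w, a ∈ J) (hlen : p ≤ w.length) :
    nestedComm w = 0 := by
  have h := nestedComm_mem_pow w hw
  obtain ⟨q, hq⟩ := Nat.exists_eq_add_of_le hlen
  rw [hq, pow_add, hp, Submodule.bot_mul] at h
  simpa using h

end DerivationFormula

/-! ### The Baker-Campbell-Hausdorff formula in a nilpotent algebra -/

section AssociativeBCH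

open PowerSeries

variable {E : Type*} [Ring E] [Algebra ℚ E]

theorem pow_mem_of_mul_le {J : Submodule ℚ E} (hJ : J * J ≤ J) {x : E} (hx : x ∈ J) (n : ℕ) :
    x ^ (n + 1) ∈ J := by
  induction n with
  | zero => simpa
  | succ n ih => rw [pow_succ]; exact hJ (Submodule.mul_mem_mul ih hx)

theorem exp_sub_one_mem {J : Submodule ℚ E} (hJ : J * J ≤ J) {p : ℕ} (hp : J ^ p = ⊥) {x : E}
    (hx : x ∈ J) : IsNilpotent.exp x - 1 ∈ J := by
  have h : x ^ (p + 1) = 0 := by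
    rw [pow_succ, show x ^ p = 0 by simpa [hp] using Submodule.pow_mem_pow J hx p, zero_mul]
  rw [IsNilpotent.exp_eq_sum h, Finset.sum_range_succ']
  simp only [pow_zero, Nat.factorial_zero, Nat.cast_one, inv_one, one_smul, add_sub_cancel_right]
  exact Submodule.sum_mem _ fun i _ => Submodule.smul_mem _ _ (pow_mem_of_mul_le hJ hx i)

/-- The polynomials whose coefficients lie in `J`. -/
def polySubmodule (J : Submodule ℚ E) : Submodule ℚ (Polynomial E) where
  carrier := {f | ∀ i, f.coeff i ∈ J}
  add_mem' hf hg i := by rw [Polynomial.coeff_add]; exact J.add_mem (hf i) (hg i)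
  zero_mem' i := by simp
  smul_mem' c f hf i := by rw [Polynomial.coeff_smul]; exact J.smul_mem c (hf i)

theorem polySubmodule_mul_le (J L : Submodule ℚ E) :
    polySubmodule J * polySubmodule L ≤ polySubmodule (J * L) := by
  rw [Submodule.mul_le]
  intro f hf g hg i
  rw [Polynomial.coeff_mul]
  exact Submodule.sum_mem _ fun ij _ => Submodule.mul_mem_mul (hf ij.1) (hg ij.2)

theorem polySubmodule_pow_le (J : Submodule ℚ E) (n : ℕ) :
    polySubmodule J ^ (n + 1) ≤ polySubmodule (J ^ (n + 1)) := by
  induction n with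
  | zero => simp
  | succ n ih =>
    rw [pow_succ, pow_succ J]
    exact (mul_le_mul' ih le_rfl).trans (polySubmodule_mul_le _ _)

theorem polySubmodule_mono {J L : Submodule ℚ E} (h : J ≤ L) : polySubmodule J ≤ polySubmodule L :=
  fun _ hf i => h (hf i)

/-- The number derivation `t d/dt` of `E[t]`. -/
noncomputable def eulerOp : Module.End ℚ (Polynomial E) :=
  LinearMap.mulLeft ℚ Polynomial.X ∘ₗ (Polynomial.derivative (R := E)).restrictScalars ℚ

theorem eulerOp_apply (f : Polynomial E) : eulerOp f = Polynomial.X * f.derivative := rfl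

/-- The Leibniz rule: inside the ring of operators the derivation `t d/dt` becomes a commutator, as
`commutator_log_exp_mul_exp` requires. -/
theorem commutator_eulerOp_mulLeft (f : Polynomial E) :
    eulerOp * Algebra.lmul ℚ _ f - Algebra.lmul ℚ _ f * eulerOp = Algebra.lmul ℚ _ (eulerOp f) := by
  ext1 g
  simp only [LinearMap.sub_apply, Module.End.mul_apply, eulerOp_apply, Algebra.coe_lmul_eq_mul,
    LinearMap.mul_apply', Polynomial.derivative_mul]
  rw [← mul_assoc f, ← Polynomial.X_mul, mul_add]
  noncomm_ring

theorem bchComm_C_mul_X (x y : E) (N : ℕ) :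
    bchComm (Polynomial.C x * Polynomial.X) (Polynomial.C y * Polynomial.X) N =
      Polynomial.C (bchComm x y N) * Polynomial.X ^ N := by
  have key : ∀ w : List E, nestedComm (w.map fun a => Polynomial.C a * Polynomial.X) =
      Polynomial.C (nestedComm w) * Polynomial.X ^ w.length := by
    intro w
    induction w with
    | nil => simp [nestedComm]
    | cons a w ih =>
      rcases eq_or_ne w [] with rfl | hw
      · simp [nestedComm]
      · rw [nestedComm_cons a hw, List.map_cons, nestedComm_cons _ (by simpa using hw), ih,
          List.length_cons, map_sub, map_mul, map_mul, sub_mul]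
        congr 1
        · rw [mul_assoc, ← mul_assoc Polynomial.X, Polynomial.X_mul_C, mul_assoc, mul_assoc,
            ← pow_succ']
        · rw [mul_assoc, ← mul_assoc (Polynomial.X ^ _), Polynomial.X_pow_mul_C, mul_assoc,
            mul_assoc, ← pow_succ]
  simp only [bchComm, map_sum, Finset.sum_mul]
  refine Finset.sum_congr rfl fun n _ => Finset.sum_congr rfl fun rs hrs => ?_
  have hlen : (bchWord x y rs).length = N := by
    rw [length_bchWord]; exact (Finset.mem_filter.mp hrs).2.2
  have hmap : bchWord (Polynomial.C x * Polynomial.X) (Polynomial.C y * Polynomial.X) rs =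
      (bchWord x y rs).map fun a => Polynomial.C a * Polynomial.X :=
    (map_bchWord (fun a => Polynomial.C a * Polynomial.X) x y rs).symm
  rw [hmap, key, hlen, map_rat_smul, smul_mul_assoc]

/-- The Baker-Campbell-Hausdorff formula for elements of a nilpotent subalgebra. -/
theorem exp_mul_exp_eq_exp_sum_bchComm {J : Submodule ℚ E} (hJ : J * J ≤ J) {p : ℕ}
    (hp : J ^ p = ⊥) {x y : E} (hx : x ∈ J) (hy : y ∈ J) :
    IsNilpotent.exp x * IsNilpotent.exp y =
      IsNilpotent.exp (∑ N ∈ Finset.range p, bchComm x y N) := by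
  -- Replace `x`, `y` by `xt`, `yt` in `E[t]`: they are eigenvectors of `t d/dt`, and powers of `t`
  -- record word length.
  set L := polySubmodule J with hL
  have hLL : L * L ≤ L := (polySubmodule_mul_le J J).trans (polySubmodule_mono hJ)
  -- The exponent `p + 1` is positive, as `polySubmodule_pow_le` needs.
  have hLp : L ^ (p + 1) = ⊥ := by
    refine le_bot_iff.mp ((polySubmodule_pow_le J p).trans ?_)
    rw [pow_succ, hp, Submodule.bot_mul]
    intro f hf
    ext i
    simpa using hf i
  set X' : Polynomial E := Polynomial.C x * Polynomial.X with hX'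
  set Y' : Polynomial E := Polynomial.C y * Polynomial.X with hY'
  have hmem : ∀ a ∈ J, Polynomial.C a * Polynomial.X ∈ L := by
    intro a ha i
    rw [Polynomial.coeff_C_mul, Polynomial.coeff_X]
    split <;> simp [ha]
  have hX'L : X' ∈ L := hmem x hx
  have hY'L : Y' ∈ L := hmem y hy
  have hnil : ∀ f ∈ L, f ^ (p + 1) = 0 := fun f hf => by
    simpa [hLp] using Submodule.pow_mem_pow L hf (p + 1)
  set u := IsNilpotent.exp X' * IsNilpotent.exp Y' - 1 with hu
  have huL : u ∈ L := by
    have h1 := exp_sub_one_mem hLL hLp hX'L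
    have h2 := exp_sub_one_mem hLL hLp hY'L
    have : u = (IsNilpotent.exp X' - 1) * (IsNilpotent.exp Y' - 1) + (IsNilpotent.exp X' - 1) +
        (IsNilpotent.exp Y' - 1) := by rw [hu]; noncomm_ring
    rw [this]
    exact L.add_mem (L.add_mem (hLL (Submodule.mul_mem_mul h1 h2)) h1) h2
  have huk := hnil u huL
  have hX'n : IsNilpotent X' := ⟨_, hnil X' hX'L⟩
  have hY'n : IsNilpotent Y' := ⟨_, hnil Y' hY'L⟩
  set Z := nilEval huk (log ℚ) with hZ
  have hZL : Z ∈ L := by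
    rw [hZ, nilEval_apply]
    refine Submodule.sum_mem _ fun i _ => ?_
    rcases i with _ | i
    · simp
    · exact L.smul_mem _ (pow_mem_of_mul_le hLL huL i)
  have hZexp : IsNilpotent.exp Z = IsNilpotent.exp X' * IsNilpotent.exp Y' := by
    rw [hZ, exp_nilEval_log, hu]; abel
  have hwords : ∀ w : List (Polynomial E), (∀ a ∈ w, a = X' ∨ a = Y') → p + 1 ≤ w.length →
      nestedComm w = 0 := by
    intro w hw hlen
    refine nestedComm_eq_zero_of_pow_eq_bot hLp w (fun a ha => ?_) hlen
    rcases hw a ha with rfl | rfl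
    · exact hX'L
    · exact hY'L
  -- The left regular representation is faithful and puts `E[t]` and `t d/dt` into one ring.
  let φ : Polynomial E →+* Module.End ℚ (Polynomial E) := (Algebra.lmul ℚ (Polynomial E)).toRingHom
  have hφ : Function.Injective φ := Algebra.lmul_injective
  have heuler : ∀ a : E, eulerOp (Polynomial.C a * Polynomial.X) = Polynomial.C a * Polynomial.X := by
    intro a
    rw [eulerOp_apply, Polynomial.derivative_C_mul, Polynomial.derivative_X, mul_one,
      Polynomial.X_mul_C]
  have hφu : φ u ^ (p + 1) = 0 := by rw [← map_pow, huk, map_zero]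
  obtain ⟨m', hm', hmain⟩ := commutator_log_exp_mul_exp (x := φ X') (y := φ Y') (D := eulerOp)
    (u := φ u) (hX'n.map φ) (hY'n.map φ)
    ((commutator_eulerOp_mulLeft X').trans (by rw [hX', heuler]; rfl))
    ((commutator_eulerOp_mulLeft Y').trans (by rw [hY', heuler]; rfl))
    hφu (by rw [← IsNilpotent.map_exp hX'n φ, ← IsNilpotent.map_exp hY'n φ, ← map_mul, hu]; simp)
    (m := p + 1) (by
      intro w hw hlen
      have hw' : ∃ v : List (Polynomial E), (∀ a ∈ v, a = X' ∨ a = Y') ∧ v.map φ = w := by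
        clear hlen
        induction w with
        | nil => exact ⟨[], by simp, rfl⟩
        | cons b w ih =>
          obtain ⟨v, hv, rfl⟩ := ih fun a ha => hw a (by simp [ha])
          rcases hw b (by simp) with rfl | rfl
          · exact ⟨X' :: v, by simpa using hv, rfl⟩
          · exact ⟨Y' :: v, by simpa using hv, rfl⟩
      obtain ⟨v, hv, rfl⟩ := hw'
      rw [← map_nestedComm, hwords v hv (by simpa using hlen), map_zero])
  rw [← map_nilEval φ huk hφu, ← hZ] at hmain
  have hmain' : eulerOp Z = ∑ N ∈ Finset.range m', (N : ℚ) • bchComm X' Y' N := by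
    apply hφ
    rw [map_sum]
    simp only [map_rat_smul, map_bchComm]
    rw [← hmain]
    exact (commutator_eulerOp_mulLeft Z).symm
  have hb : ∀ N, p ≤ N → bchComm x y N = 0 := by
    intro N hN
    refine Finset.sum_eq_zero fun n _ => Finset.sum_eq_zero fun rs hrs => ?_
    rw [nestedComm_eq_zero_of_pow_eq_bot hp (bchWord x y rs), smul_zero]
    · intro a ha
      rcases mem_bchWord ha with rfl | rfl
      · exact hx
      · exact hy
    · rw [length_bchWord, (Finset.mem_filter.mp hrs).2.2]; exact hN
  -- Compare coefficients of `t^{N+1}` and divide by `N + 1`; past the summation bound both sides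
  -- vanish by `hb`.
  have hcoeff : ∀ N, Z.coeff (N + 1) = bchComm x y (N + 1) := by
    intro N
    have h := congrArg (fun f => Polynomial.coeff f (N + 1)) hmain'
    simp only [eulerOp_apply, Polynomial.coeff_X_mul, Polynomial.coeff_derivative,
      Polynomial.finsetSum_coeff, Polynomial.coeff_smul, hX', hY', bchComm_C_mul_X,
      Polynomial.coeff_C_mul, Polynomial.coeff_X_pow, mul_ite, mul_one, mul_zero, smul_ite,
      smul_zero, Finset.sum_ite_eq, Finset.mem_range] at h
    have hne : ((N + 1 : ℕ) : ℚ) ≠ 0 := by positivity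
    have h2 : ((N + 1 : ℕ) : ℚ) • Z.coeff (N + 1) = ((N + 1 : ℕ) : ℚ) • bchComm x y (N + 1) := by
      have h3 : Z.coeff (N + 1) * ((N : E) + 1) = ((N + 1 : ℕ) : ℚ) • Z.coeff (N + 1) := by
        rw [Nat.cast_smul_eq_nsmul, nsmul_eq_mul, Nat.cast_comm]
        push_cast
        rfl
      rw [← h3, h]
      split
      · rfl
      · rw [hb _ (by omega), smul_zero]
    exact smul_right_injective _ hne h2
  -- The operator `t d/dt` does not see the constant term, which vanishes because `u` has none.
  have hcoeff0 : Z.coeff 0 = 0 := by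
    have hc : ∀ a : E, Polynomial.constantCoeff (Polynomial.C a * Polynomial.X) = 0 := by simp
    have hu0 : Polynomial.constantCoeff u = 0 := by
      rw [hu, map_sub, map_mul, IsNilpotent.map_exp hX'n, IsNilpotent.map_exp hY'n, hX', hY', hc,
        hc, IsNilpotent.exp_zero, map_one]
      simp
    have h0 : Polynomial.constantCoeff u ^ (p + 1) = 0 := by rw [hu0]; simp
    rw [← Polynomial.constantCoeff_apply, hZ, map_nilEval Polynomial.constantCoeff huk h0,
      nilEval_apply]
    refine Finset.sum_eq_zero fun i _ => ?_
    rcases i with _ | i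
    · simp
    · simp [hu0]
  -- Setting `t = 1` is a ring homomorphism although `E` need not be commutative, because 1 is
  -- central.
  let ev : Polynomial E →+* E := Polynomial.eval₂RingHom' (RingHom.id E) 1 fun a => Commute.one_right a
  have hev : ∀ a : E, ev (Polynomial.C a * Polynomial.X) = a := by
    intro a
    rw [map_mul]
    change Polynomial.eval₂ _ _ _ * Polynomial.eval₂ _ _ _ = _
    simp
  have hevZ : ev Z = ∑ N ∈ Finset.range p, bchComm x y N := by
    have hb0 : bchComm x y 0 = 0 := by simp [bchComm]
    have hall : ∀ N, Z.coeff N = bchComm x y N := by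
      intro N
      cases N with
      | zero => rw [hcoeff0, hb0]
      | succ N => exact hcoeff N
    have h1 : ev Z = ∑ N ∈ Finset.range (Z.natDegree + p + 1), Z.coeff N := by
      change Polynomial.eval₂ _ _ _ = _
      rw [Polynomial.eval₂_eq_sum_range' _ (n := Z.natDegree + p + 1) (by omega)]
      simp
    rw [h1, Finset.sum_congr rfl fun N _ => hall N]
    symm
    refine Finset.sum_subset (Finset.range_subset_range.mpr (by omega)) fun N _ hN => ?_
    exact hb N (by simpa using hN)
  have hZn : IsNilpotent Z := ⟨_, hnil Z hZL⟩
  have hfin := congrArg ev hZexp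
  rw [map_mul, IsNilpotent.map_exp hZn, IsNilpotent.map_exp hX'n, IsNilpotent.map_exp hY'n, hevZ,
    hX', hY', hev, hev] at hfin
  exact hfin.symm

end AssociativeBCH

/-! ### Symmetric braces: symmetry, Leibniz rule, filtrations -/

section SymmetricBraces

variable {K : Type*} {V : Type*} [Field K] [AddCommGroup V] [Module K V]

/-- The symmetric braces of a bilinear product. -/
def gbrace (s : V →ₗ[K] V →ₗ[K] V) : (n : ℕ) → (Fin n → V) → V → V
  | 0, _, a => a
  | n + 1, b, a =>
      s (gbrace s n (Fin.init b) a) (b (Fin.last n)) -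
        ∑ i : Fin n, gbrace s n
          (Function.update (Fin.init b) i (s (b i.castSucc) (b (Fin.last n)))) a

theorem brace_eq_gbrace {A : Type*} [AddCommGroup A] [Module K A] (P : DGPreLie K A) (n : ℕ)
    (b : Fin n → A) (a : A) : P.brace n b a = gbrace P.star n b a := by
  induction n with
  | zero => rfl
  | succ n ih => simp only [DGPreLie.brace, gbrace, ih]

/-- Appending an entry to a nondependent tuple. -/
abbrev tsnoc {T : Type*} {n : ℕ} (b : Fin n → T) (z : T) : Fin (n + 1) → T :=
  Fin.snoc (α := fun _ => T) b z

variable (s : V →ₗ[K] V →ₗ[K] V)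

theorem gbrace_tsnoc (n : ℕ) (b : Fin n → V) (z a : V) :
    gbrace s (n + 1) (tsnoc b z) a = s (gbrace s n b a) z -
      ∑ i, gbrace s n (Function.update b i (s (b i) z)) a := by
  simp [gbrace, tsnoc]

theorem exists_eq_tsnoc {T : Type*} {n : ℕ} (b : Fin (n + 1) → T) :
    ∃ (b' : Fin n → T) (z : T), b = tsnoc b' z :=
  ⟨Fin.init b, b (Fin.last n), (Fin.snoc_init_self b).symm⟩

theorem gbrace_update_add (n : ℕ) (b : Fin n → V) (i : Fin n) (x y a : V) :
    gbrace s n (Function.update b i (x + y)) a =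
      gbrace s n (Function.update b i x) a + gbrace s n (Function.update b i y) a := by
  induction n generalizing x y with
  | zero => exact i.elim0
  | succ n ih =>
    obtain ⟨b, z, rfl⟩ := exists_eq_tsnoc b
    cases i using Fin.lastCases with
    | last =>
      simp only [tsnoc, Fin.update_snoc_last]
      have h := fun w => gbrace_tsnoc s n b w a
      simp only [tsnoc] at h
      rw [h, h, h, map_add, Finset.sum_congr rfl fun k _ => (by rw [map_add, ih] :
        gbrace s n (Function.update b k (s (b k) (x + y))) a =
          gbrace s n (Function.update b k (s (b k) x)) a +
            gbrace s n (Function.update b k (s (b k) y)) a), Finset.sum_add_distrib]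
      abel
    | cast j =>
      simp only [tsnoc, ← Fin.snoc_update]
      have h := fun c : Fin n → V => gbrace_tsnoc s n c z a
      simp only [tsnoc] at h
      simp only [h, ih, map_add, LinearMap.add_apply]
      have hsum : ∀ k : Fin n,
          gbrace s n (Function.update (Function.update b j (x + y)) k
            (s (Function.update b j (x + y) k) z)) a =
          gbrace s n (Function.update (Function.update b j x) k
            (s (Function.update b j x k) z)) a +
          gbrace s n (Function.update (Function.update b j y) k
            (s (Function.update b j y k) z)) a := by
        intro k
        rcases eq_or_ne k j with rfl | hk
        · simp only [Function.update_self, Function.update_idem, map_add, LinearMap.add_apply]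
          exact ih ..
        · simp only [Function.update_of_ne hk]
          have hc : ∀ v : V, Function.update (Function.update b j v) k (s (b k) z) =
              Function.update (Function.update b k (s (b k) z)) j v :=
            fun v => Function.update_comm hk.symm _ _ _
          rw [hc, hc, hc, ih]
      rw [Finset.sum_congr rfl fun k _ => hsum k, Finset.sum_add_distrib]
      abel

/-- Modifying two entries in either order gives the same sum, up to the diagonal terms. -/
theorem sum_sum_gbrace_update (n : ℕ) (b : Fin n → V) (f g : V → V) (a : V) :
    ∑ i, ∑ j, gbrace s n (Function.update (Function.update b i (f (b i))) j
        (g (Function.update b i (f (b i)) j))) a +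
      ∑ i, gbrace s n (Function.update b i (f (g (b i)))) a =
    ∑ i, ∑ j, gbrace s n (Function.update (Function.update b i (g (b i))) j
        (f (Function.update b i (g (b i)) j))) a +
      ∑ i, gbrace s n (Function.update b i (g (f (b i)))) a := by
  have key : ∀ f g : V → V, ∀ i j : Fin n,
      gbrace s n (Function.update (Function.update b i (f (b i))) j
        (g (Function.update b i (f (b i)) j))) a =
      if i = j then gbrace s n (Function.update b i (g (f (b i)))) a else
        gbrace s n (Function.update (Function.update b i (f (b i))) j (g (b j))) a := by
    intro f g i j
    split_ifs with h
    · subst h; simp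
    · rw [Function.update_of_ne (Ne.symm h)]
  have key2 : ∀ f g : V → V,
      ∑ i, ∑ j, gbrace s n (Function.update (Function.update b i (f (b i))) j
        (g (Function.update b i (f (b i)) j))) a =
      ∑ i, ∑ j, (if i = j then 0 else
        gbrace s n (Function.update (Function.update b i (f (b i))) j (g (b j))) a) +
      ∑ i, gbrace s n (Function.update b i (g (f (b i)))) a := by
    intro f g
    rw [← Finset.sum_add_distrib]
    refine Finset.sum_congr rfl fun i _ => ?_
    have : gbrace s n (Function.update b i (g (f (b i)))) a =
        ∑ j, if i = j then gbrace s n (Function.update b i (g (f (b i)))) a else 0 := by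
      rw [Finset.sum_ite_eq]; simp
    rw [this, ← Finset.sum_add_distrib]
    refine Finset.sum_congr rfl fun j _ => ?_
    rw [key]
    split_ifs <;> simp
  have hsym : ∑ i, ∑ j, (if i = j then 0 else
        gbrace s n (Function.update (Function.update b i (f (b i))) j (g (b j))) a) =
      ∑ i, ∑ j, (if i = j then 0 else
        gbrace s n (Function.update (Function.update b i (g (b i))) j (f (b j))) a) := by
    rw [Finset.sum_comm]
    refine Finset.sum_congr rfl fun i _ => Finset.sum_congr rfl fun j _ => ?_
    by_cases h : i = j
    · simp [h]
    · rw [if_neg h, if_neg (Ne.symm h), Function.update_comm h]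
  rw [key2, key2, hsym]
  abel

/-- Unfold the recursion twice. The associator of `{a; b}, y, z` is symmetric by hypothesis, and so
is the sum of the terms changing one entry before multiplying. Double changes are symmetric up to
diagonal terms, which the associators of `bᵢ, y, z` absorb. -/
theorem gbrace_tsnoc_comm (n : ℕ) (b : Fin n → V) (y z a : V)
    (hyz : ∀ x, s (s x y) z - s x (s y z) = s (s x z) y - s x (s z y)) :
    gbrace s (n + 2) (tsnoc (tsnoc b y) z) a = gbrace s (n + 2) (tsnoc (tsnoc b z) y) a := by
  have hexp : ∀ y z : V, gbrace s (n + 2) (tsnoc (tsnoc b y) z) a =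
      (s (s (gbrace s n b a) y) z - s (gbrace s n b a) (s y z)) -
      (∑ i, s (gbrace s n (Function.update b i (s (b i) y)) a) z +
        ∑ i, s (gbrace s n (Function.update b i (s (b i) z)) a) y) +
      (∑ i, ∑ j, gbrace s n (Function.update (Function.update b i (s (b i) z)) j
        (s (Function.update b i (s (b i) z) j) y)) a +
        ∑ i, gbrace s n (Function.update b i (s (b i) (s y z))) a) := by
    intro y z
    rw [gbrace_tsnoc, Fin.sum_univ_castSucc]
    simp only [tsnoc, Fin.snoc_castSucc, Fin.snoc_last, Fin.update_snoc_last, ← Fin.snoc_update]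
    have h := fun (c : Fin n → V) (z : V) => gbrace_tsnoc s n c z a
    simp only [tsnoc] at h
    simp only [h, Finset.sum_sub_distrib, map_sub, map_sum, LinearMap.sub_apply,
      LinearMap.sum_apply]
    abel
  have h1 := sum_sum_gbrace_update s n b (fun x => s x z) (fun x => s x y) a
  have h2 : ∀ i, gbrace s n (Function.update b i (s (b i) (s y z))) a =
      gbrace s n (Function.update b i (s (s (b i) y) z)) a -
      gbrace s n (Function.update b i (s (s (b i) z) y)) a +
      gbrace s n (Function.update b i (s (b i) (s z y))) a := by
    intro i
    have h3 : s (b i) (s y z) + s (s (b i) z) y = s (s (b i) y) z + s (b i) (s z y) := by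
      have h4 := hyz (b i)
      rw [sub_eq_sub_iff_add_eq_add] at h4
      rw [add_comm, h4.symm.trans rfl]
    have h5 := congrArg (fun v => gbrace s n (Function.update b i v) a) h3
    simp only [gbrace_update_add] at h5
    rw [sub_add_eq_add_sub, eq_sub_iff_add_eq, h5]
  rw [hexp y z, hexp z y, hyz, add_comm (∑ i, s (gbrace s n (Function.update b i (s (b i) y)) a) z)]
  congr 1
  rw [Finset.sum_congr rfl fun i _ => h2 i, Finset.sum_add_distrib, Finset.sum_sub_distrib,
    ← add_assoc, add_right_cancel_iff, ← add_sub_assoc, sub_eq_iff_eq_add]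
  exact h1

/-- A submodule that is closed under a product and consists of right-symmetric elements. -/
structure RightSymmetricOn (B : Submodule K V) : Prop where
  mul_mem : ∀ {x y}, x ∈ B → y ∈ B → s x y ∈ B
  symm : ∀ (x : V) {y z}, y ∈ B → z ∈ B → s (s x y) z - s x (s y z) = s (s x z) y - s x (s z y)

variable {s}

theorem gbrace_tsnoc_perm {n : ℕ} {b : Fin n → V} {z a : V} (σ : Equiv.Perm (Fin n))
    (h : ∀ c : Fin n → V, (c = b ∨ ∃ i, c = Function.update b i (s (b i) z)) →
      gbrace s n (c ∘ σ) a = gbrace s n c a) :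
    gbrace s (n + 1) (tsnoc (b ∘ σ) z) a = gbrace s (n + 1) (tsnoc b z) a := by
  rw [gbrace_tsnoc, gbrace_tsnoc, h b (Or.inl rfl)]
  congr 1
  rw [← Equiv.sum_comp σ fun i => gbrace s n (Function.update b i (s (b i) z)) a]
  refine Finset.sum_congr rfl fun i _ => ?_
  rw [← h _ (Or.inr ⟨σ i, rfl⟩)]
  congr 1
  rw [Function.update_comp_eq_of_injective _ σ.injective]
  rfl

/-- Adjacent transpositions generate. The one of the last two entries is `gbrace_tsnoc_comm`; the
others fix the last entry and pass through the recursion, whose modified entries stay in `B`. -/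
theorem RightSymmetricOn.gbrace_perm {B : Submodule K V} (hB : RightSymmetricOn s B) {n : ℕ}
    (σ : Equiv.Perm (Fin n)) (b : Fin n → V) (hb : ∀ i, b i ∈ B) (a : V) :
    gbrace s n (b ∘ σ) a = gbrace s n b a := by
  induction n with
  | zero => rw [Subsingleton.elim σ 1]; rfl
  | succ n ih =>
    have hmem : σ ∈ Submonoid.closure
        (Set.range fun i : Fin n => Equiv.swap i.castSucc i.succ) := by
      rw [Equiv.Perm.mclosure_swap_castSucc_succ]; trivial
    induction hmem using Submonoid.closure_induction generalizing b with
    | one => rfl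
    | mul σ τ _ _ hσ hτ =>
      have h1 := hτ (b ∘ σ) fun i => hb _
      rw [Function.comp_assoc] at h1
      rw [Equiv.Perm.coe_mul, h1, hσ b hb]
    | mem σ hσ =>
      obtain ⟨i, rfl⟩ := hσ
      cases n with
      | zero => exact i.elim0
      | succ n =>
        obtain ⟨b, z, rfl⟩ := exists_eq_tsnoc b
        have hz : z ∈ B := by simpa [tsnoc] using hb (Fin.last _)
        have hb' : ∀ i, b i ∈ B := fun i => by simpa [tsnoc] using hb i.castSucc
        cases i using Fin.lastCases with
        | last =>
          obtain ⟨b, y, rfl⟩ := exists_eq_tsnoc b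
          have hy : y ∈ B := by simpa [tsnoc] using hb' (Fin.last _)
          rw [gbrace_tsnoc_comm s n b y z a fun x => hB.symm x hy hz]
          congr 1
          funext k
          cases k using Fin.lastCases with
          | last => simp [tsnoc]
          | cast k =>
            cases k using Fin.lastCases with
            | last => simp [tsnoc]
            | cast k =>
              have h1 : k.castSucc.castSucc ≠ (Fin.last n).castSucc := by
                simp [Fin.ext_iff]; omega
              have h2 : k.castSucc.castSucc ≠ (Fin.last n).succ := by
                simp [Fin.ext_iff]; omega
              rw [Function.comp_apply, Equiv.swap_apply_of_ne_of_ne h1 h2]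
              simp [tsnoc]
        | cast j =>
          have hperm : (tsnoc b z) ∘ Equiv.swap j.castSucc.castSucc j.castSucc.succ =
              tsnoc (b ∘ Equiv.swap j.castSucc j.succ) z := by
            funext k
            cases k using Fin.lastCases with
            | last =>
              have h1 : Fin.last (n + 1) ≠ j.castSucc.castSucc := by simp [Fin.ext_iff]; omega
              have h2 : Fin.last (n + 1) ≠ j.castSucc.succ := by simp [Fin.ext_iff]; omega
              simp [tsnoc, Equiv.swap_apply_of_ne_of_ne h1 h2]
            | cast k =>
              have h3 : Equiv.swap j.castSucc.castSucc j.castSucc.succ k.castSucc =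
                  (Equiv.swap j.castSucc j.succ k).castSucc := by
                rw [← Fin.castSucc_succ, ← Function.Injective.swap_apply
                  (Fin.castSucc_injective _)]
              simp only [Function.comp_apply, h3, tsnoc, Fin.snoc_castSucc]
          rw [hperm]
          refine gbrace_tsnoc_perm _ fun c hc => ih _ c fun i => ?_
          rcases hc with rfl | ⟨k, rfl⟩
          · exact hb' i
          · rw [Function.update_apply]
            split
            · exact hB.mul_mem (hb' k) hz
            · exact hb' i

/-- By symmetry the position of `y` is irrelevant. The resulting factor `n + 1` is what reduces
`1/(n+1)!` to `1/n!` in the circle product. -/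
theorem RightSymmetricOn.sum_gbrace_update_const {B : Submodule K V} (hB : RightSymmetricOn s B)
    (n : ℕ) {b y : V} (hb : b ∈ B) (hy : y ∈ B) (a : V) :
    ∑ i : Fin (n + 1), gbrace s (n + 1) (Function.update (fun _ => b) i y) a =
      (n + 1) • gbrace s (n + 1) (tsnoc (fun _ => b) y) a := by
  have h : ∀ i : Fin (n + 1), gbrace s (n + 1) (Function.update (fun _ => b) i y) a =
      gbrace s (n + 1) (tsnoc (fun _ => b) y) a := by
    intro i
    have hs : tsnoc (fun _ : Fin n => b) y = Function.update (fun _ => b) (Fin.last n) y := by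
      funext k
      cases k using Fin.lastCases with
      | last => simp [tsnoc]
      | cast k => simp [tsnoc, Fin.castSucc_ne_last k]
    have hp : (Function.update (fun _ : Fin (n + 1) => b) i y) =
        (tsnoc (fun _ => b) y) ∘ Equiv.swap i (Fin.last n) := by
      rw [hs]
      funext k
      simp only [Function.comp_apply, Function.update_apply]
      congr 1
      rw [Equiv.swap_apply_eq_iff, Equiv.swap_apply_right]
    rw [hp]
    refine hB.gbrace_perm _ _ (fun k => ?_) a
    rw [hs, Function.update_apply]
    split <;> assumption
  rw [Finset.sum_congr rfl fun i _ => h i]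
  simp

/-- Induction on the recursion. Applying `E` and multiplying by the last entry are done to the slots
in both orders, and `sum_sum_gbrace_update` compares them. -/
theorem map_gbrace_of_derivation {E : V →ₗ[K] V} (hE : ∀ x y, E (s x y) = s (E x) y + s x (E y))
    (n : ℕ) (b : Fin n → V) (a : V) :
    E (gbrace s n b a) = gbrace s n b (E a) +
      ∑ i, gbrace s n (Function.update b i (E (b i))) a := by
  induction n with
  | zero => simp [gbrace]
  | succ n ih =>
    obtain ⟨b, z, rfl⟩ := exists_eq_tsnoc b
    rw [Fin.sum_univ_castSucc]
    simp only [tsnoc, Fin.snoc_castSucc, Fin.snoc_last, Fin.update_snoc_last, ← Fin.snoc_update]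
    have h := fun (c : Fin n → V) (z a : V) => gbrace_tsnoc s n c z a
    simp only [tsnoc] at h
    have h1 := sum_sum_gbrace_update s n b (fun x => s x z) E a
    simp only [hE, gbrace_update_add, Finset.sum_add_distrib] at h1
    simp only [h, map_sub, map_sum, hE, ih, map_add, Finset.sum_add_distrib, LinearMap.add_apply,
      LinearMap.sum_apply, Finset.sum_sub_distrib]
    rw [← sub_eq_zero] at h1 ⊢
    rw [← neg_eq_zero, ← h1]
    abel

theorem gbrace_mem_of_mul_mem {D : Submodule K V} {B : Submodule K V}
    (hB : ∀ {x y}, x ∈ B → y ∈ B → s x y ∈ B) (hD : ∀ {x y}, x ∈ D → y ∈ B → s x y ∈ D)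
    {n : ℕ} {b : Fin n → V} (hb : ∀ i, b i ∈ B) {a : V} (ha : a ∈ D) : gbrace s n b a ∈ D := by
  induction n with
  | zero => exact ha
  | succ n ih =>
    refine D.sub_mem (hD (ih fun i => hb _) (hb _)) (D.sum_mem fun i _ => ih fun j => ?_)
    rw [Function.update_apply]
    split
    · exact hB (hb _) (hb _)
    · exact hb _

theorem gbrace_mem_filtration {F : ℕ → Submodule K V}
    (hs : ∀ {i j x y}, x ∈ F i → y ∈ F j → s x y ∈ F (i + j))
    {n k : ℕ} {b : Fin n → V} {w : Fin n → ℕ} (hb : ∀ i, b i ∈ F (w i)) {a : V} (ha : a ∈ F k) :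
    gbrace s n b a ∈ F (k + ∑ i, w i) := by
  induction n with
  | zero => simpa [gbrace] using ha
  | succ n ih =>
    obtain ⟨b, z, rfl⟩ := exists_eq_tsnoc b
    obtain ⟨w, v, rfl⟩ := exists_eq_tsnoc w
    have hz : z ∈ F v := by simpa [tsnoc] using hb (Fin.last _)
    have hb' : ∀ i, b i ∈ F (w i) := fun i => by simpa [tsnoc] using hb i.castSucc
    rw [gbrace_tsnoc, Fin.sum_univ_castSucc]
    simp only [tsnoc, Fin.snoc_castSucc, Fin.snoc_last]
    refine Submodule.sub_mem _ ?_ (Submodule.sum_mem _ fun i _ => ?_)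
    · rw [← add_assoc]
      exact hs (ih hb') hz
    · have h := ih (b := Function.update b i (s (b i) z)) (w := Function.update w i (w i + v))
        fun j => by
          rcases eq_or_ne j i with rfl | hj
          · simpa using hs (hb' j) hz
          · simpa [hj] using hb' j
      convert h using 2
      rw [Finset.sum_update_of_mem (Finset.mem_univ i),
        ← Finset.add_sum_erase _ _ (Finset.mem_univ i), Finset.sdiff_singleton_eq_erase]
      ring

/-- Braces are built from products and differences only. Applied to `evalRel`, this passes from
braces of power series to braces of their sums. -/
theorem gbrace_rel {V' : Type*} [AddCommGroup V'] [Module K V'] {s' : V' →ₗ[K] V' →ₗ[K] V'}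
    (R : AddSubgroup (V × V'))
    (hR : ∀ {x y}, x ∈ R → y ∈ R → (s x.1 y.1, s' x.2 y.2) ∈ R)
    {n : ℕ} {b : Fin n → V} {b' : Fin n → V'} (hb : ∀ i, (b i, b' i) ∈ R) {a : V} {a' : V'}
    (ha : (a, a') ∈ R) : (gbrace s n b a, gbrace s' n b' a') ∈ R := by
  induction n with
  | zero => exact ha
  | succ n ih =>
    have h1 := hR (ih (b := Fin.init b) (b' := Fin.init b') fun i => hb _) (hb (Fin.last n))
    have h2 : ∀ i : Fin n, _ := fun i =>
      ih (b := Function.update (Fin.init b) i (s (b i.castSucc) (b (Fin.last n))))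
        (b' := Function.update (Fin.init b') i (s' (b' i.castSucc) (b' (Fin.last n)))) fun j => by
          rw [Function.update_apply, Function.update_apply]
          split
          · exact hR (hb _) (hb _)
          · exact hb _
    have h3 := R.sub_mem h1 (R.sum_mem (t := Finset.univ) fun i _ => h2 i)
    convert h3 using 1
    simp [gbrace, Prod.ext_iff, Prod.fst_sum, Prod.snd_sum]

end SymmetricBraces

/-! ### Power series in `t` and the differential equation `c' = c ⋆ l` -/

section Convolution

variable {K : Type*} {A : Type*} [Field K] [AddCommGroup A] [Module K A]

/-- The extension of a bilinear product to formal power series in one variable. -/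
def convStar (s : A →ₗ[K] A →ₗ[K] A) : (ℕ → A) →ₗ[K] (ℕ → A) →ₗ[K] (ℕ → A) :=
  LinearMap.mk₂ K (fun f g n => ∑ ij ∈ Finset.HasAntidiagonal.antidiagonal n, s (f ij.1) (g ij.2))
    (fun f f' g => by ext n; simp [Finset.sum_add_distrib])
    (fun c f g => by ext n; simp [Finset.smul_sum])
    (fun f g g' => by ext n; simp [Finset.sum_add_distrib])
    (fun c f g => by ext n; simp [Finset.smul_sum])

variable (s : A →ₗ[K] A →ₗ[K] A)

theorem convStar_apply (f g : ℕ → A) (n : ℕ) :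
    convStar s f g n = ∑ ij ∈ Finset.HasAntidiagonal.antidiagonal n, s (f ij.1) (g ij.2) := rfl

theorem sum_antidiagonal_assoc {M : Type*} [AddCommMonoid M] (F : ℕ → ℕ → ℕ → M) (n : ℕ) :
    ∑ mk ∈ Finset.HasAntidiagonal.antidiagonal n,
        ∑ ij ∈ Finset.HasAntidiagonal.antidiagonal mk.1, F ij.1 ij.2 mk.2 =
      ∑ im ∈ Finset.HasAntidiagonal.antidiagonal n,
        ∑ jk ∈ Finset.HasAntidiagonal.antidiagonal im.2, F im.1 jk.1 jk.2 := by
  simp only [Finset.sum_sigma']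
  refine Finset.sum_nbij' (fun p ↦ ⟨(p.2.1, p.2.2 + p.1.2), (p.2.2, p.1.2)⟩)
    (fun p ↦ ⟨(p.1.1 + p.2.1, p.2.2), (p.1.1, p.2.1)⟩) ?_ ?_ ?_ ?_ ?_ <;>
  · rintro ⟨⟨i, j⟩, ⟨k, l⟩⟩ h
    simp only [Finset.mem_sigma, Finset.HasAntidiagonal.mem_antidiagonal] at h
    obtain ⟨rfl, rfl⟩ := h
    simp [add_assoc]

variable {s}

theorem RightSymmetricOn.convStar {B : Submodule K A} (hB : RightSymmetricOn s B) :
    RightSymmetricOn (convStar s) (Submodule.pi Set.univ fun _ : ℕ => B) where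
  mul_mem {x y} hx hy n _ := by
    rw [convStar_apply]
    exact B.sum_mem fun ij _ => hB.mul_mem (hx ij.1 trivial) (hy ij.2 trivial)
  symm x y z hy hz := by
    have key : ∀ y z : ℕ → A, _root_.convStar s (_root_.convStar s x y) z -
        _root_.convStar s x (_root_.convStar s y z) = fun n =>
        ∑ im ∈ Finset.HasAntidiagonal.antidiagonal n,
          ∑ jk ∈ Finset.HasAntidiagonal.antidiagonal im.2,
          (s (s (x im.1) (y jk.1)) (z jk.2) - s (x im.1) (s (y jk.1) (z jk.2))) := by
      intro y z
      ext n
      simp only [Pi.sub_apply, convStar_apply, map_sum, LinearMap.sum_apply,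
        Finset.sum_sub_distrib]
      rw [sum_antidiagonal_assoc fun i j k => s (s (x i) (y j)) (z k)]
    rw [key, key]
    ext n
    refine Finset.sum_congr rfl fun im _ => ?_
    rw [← Finset.Nat.sum_antidiagonal_swap]
    exact Finset.sum_congr rfl fun jk _ => hB.symm _ (hy _ trivial) (hz _ trivial)

variable (K A) in
/-- The number derivation `t d/dt` of power series. -/
def eulerSeries : (ℕ → A) →ₗ[K] (ℕ → A) where
  toFun f n := (n : K) • f n
  map_add' f g := by ext n; simp
  map_smul' c f := by ext n; exact smul_comm _ _ _

theorem eulerSeries_apply (f : ℕ → A) (n : ℕ) : eulerSeries K A f n = (n : K) • f n := rfl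

theorem eulerSeries_convStar (f g : ℕ → A) : eulerSeries K A (convStar s f g) =
    convStar s (eulerSeries K A f) g + convStar s f (eulerSeries K A g) := by
  ext n
  simp only [Pi.add_apply, convStar_apply, eulerSeries_apply, ← Finset.sum_add_distrib,
    Finset.smul_sum]
  refine Finset.sum_congr rfl fun ij hij => ?_
  rw [← Finset.HasAntidiagonal.mem_antidiagonal.mp hij]
  simp [add_smul]

variable (K A) in
/-- The power series of order at least `k`. -/
def orderFiltration (k : ℕ) : Submodule K (ℕ → A) where
  carrier := {f | ∀ n < k, f n = 0}
  add_mem' hf hg n hn := by simp [hf n hn, hg n hn]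
  zero_mem' n _ := rfl
  smul_mem' c f hf n hn := by simp [hf n hn]

theorem convStar_mem_orderFiltration {i j : ℕ} {f g : ℕ → A} (hf : f ∈ orderFiltration K A i)
    (hg : g ∈ orderFiltration K A j) : convStar s f g ∈ orderFiltration K A (i + j) := by
  intro n hn
  rw [convStar_apply]
  refine Finset.sum_eq_zero fun pq hpq => ?_
  rw [Finset.HasAntidiagonal.mem_antidiagonal] at hpq
  rcases Nat.lt_or_ge pq.1 i with h | h
  · simp [hf _ h]
  · simp [hg pq.2 (by omega)]

theorem convStar_single_succ (f : ℕ → A) (l : A) (n : ℕ) :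
    convStar s f (Pi.single 1 l) (n + 1) = s (f n) l := by
  rw [convStar_apply, Finset.sum_eq_single (n, 1)]
  · simp
  · intro ij hij hne
    rw [Finset.HasAntidiagonal.mem_antidiagonal] at hij
    have : ij.2 ≠ 1 := fun h => hne (Prod.ext (by simp; omega) h)
    simp [this]
  · simp

theorem convStar_single_zero (f : ℕ → A) (l : A) :
    convStar s f (Pi.single 1 l) 0 = 0 := by
  simp [convStar_apply]

variable [CharZero K]

/-- The circle product with the exponential of `t l` solves `c' = c ⋆ l`. -/
theorem sum_gbrace_convStar_exp {B : Submodule K A} (hB : RightSymmetricOn s B) {l : A}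
    (hl : l ∈ B) {b : ℕ → A} (hb0 : b 0 = 0) (hb1 : b 1 = l)
    (hb : ∀ n : ℕ, ((n : K) + 2) • b (n + 2) = s (b (n + 1)) l) (a : A) (N : ℕ) :
    ∑ n ∈ Finset.range (N + 1),
        (n.factorial : K)⁻¹ • gbrace (convStar s) n (fun _ => b) (Pi.single 0 a) N =
      (N.factorial : K)⁻¹ • ((s.flip l) ^ N) a := by
  have hB' := hB.convStar
  set Λ : ℕ → A := Pi.single 1 l with hΛ
  set E := eulerSeries K A
  have hbmem : b ∈ Submodule.pi Set.univ fun _ : ℕ => B := by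
    have h : ∀ n, b (n + 1) ∈ B := by
      intro n
      induction n with
      | zero => rw [hb1]; exact hl
      | succ n ih =>
        have h1 : ((n : K) + 2) ≠ 0 := by exact_mod_cast (by omega : n + 2 ≠ 0)
        rw [show b (n + 1 + 1) = ((n : K) + 2)⁻¹ • s (b (n + 1)) l by
          rw [← hb, smul_smul, inv_mul_cancel₀ h1, one_smul]]
        exact B.smul_mem _ (hB.mul_mem ih hl)
    rintro (_ | n) _
    · rw [hb0]; exact B.zero_mem
    · exact h n
  have hΛmem : Λ ∈ Submodule.pi Set.univ fun _ : ℕ => B := by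
    intro n _
    rw [hΛ, Pi.single_apply]
    split
    · exact hl
    · exact B.zero_mem
  have hbo : b ∈ orderFiltration K A 1 := fun n hn => by rw [Nat.lt_one_iff.mp hn, hb0]
  have hΛo : Λ ∈ orderFiltration K A 1 := fun n hn => by rw [Nat.lt_one_iff.mp hn]; simp [hΛ]
  -- This is `t` times `b' = l + b ⋆ l`, the equation of `b = e^{tl} - 1`, with `Λ = tl`.
  have hEb : E b = Λ + convStar s b Λ := by
    ext n
    rcases n with _ | _ | n
    · simp [E, eulerSeries_apply, hΛ, convStar_single_zero]
    · simp [E, eulerSeries_apply, hΛ, convStar_single_succ, hb0, hb1]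
    · rw [eulerSeries_apply, Pi.add_apply, hΛ, convStar_single_succ, ← hb]
      simp [add_assoc, one_add_one_eq_two]
  have hbΛ := hB'.mul_mem hbmem hΛmem
  set C : ℕ → ℕ → A := fun n => gbrace (convStar s) n (fun _ => b) (Pi.single 0 a) with hC
  set U : ℕ → ℕ → A := fun n => ∑ i : Fin n, gbrace (convStar s) n
    (Function.update (fun _ => b) i (convStar s b Λ)) (Pi.single 0 a) with hU
  have hE0 : E (Pi.single 0 a) = 0 := by
    ext n
    rcases n with _ | n <;> simp [E, eulerSeries_apply]
  -- Leibniz and `hEb`: the summand `Λ` gives `n + 1` copies of `{a; b, …, b, Λ}`, which the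
  -- recursion splits into `C n ⋆ Λ - U n`; the summand `b ⋆ Λ` gives `U (n + 1)`.
  have hEC : ∀ n, E (C (n + 1)) = ((n : K) + 1) • (convStar s (C n) Λ - U n) + U (n + 1) := by
    intro n
    have h1 := map_gbrace_of_derivation (s := convStar s) (E := E) eulerSeries_convStar (n + 1)
      (fun _ => b) (Pi.single 0 a)
    have hz : gbrace (convStar s) (n + 1) (fun _ => b) (0 : ℕ → A) = 0 := by
      simpa using gbrace_mem_of_mul_mem (s := convStar s) (D := ⊥) (B := ⊤) (by simp)
        (by rintro x y hx -; simp [(Submodule.mem_bot K).mp hx]) (b := fun _ : Fin (n + 1) => b)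
        (by simp) (Submodule.zero_mem _)
    rw [hE0, hz, zero_add] at h1
    simp only [hC]
    rw [h1]
    simp only [hEb, gbrace_update_add, Finset.sum_add_distrib]
    rw [hB'.sum_gbrace_update_const n hbmem hΛmem, gbrace_tsnoc, ← Nat.cast_smul_eq_nsmul K]
    simp [hU]
  have hUo : ∀ n, U n ∈ orderFiltration K A n := by
    intro n
    refine Submodule.sum_mem _ fun i _ => ?_
    have := gbrace_mem_filtration (s := convStar s) (F := orderFiltration K A)
      convStar_mem_orderFiltration (n := n) (k := 0)
      (b := Function.update (fun _ => b) i (convStar s b Λ)) (w := fun _ => 1) (fun j => by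
        rw [Function.update_apply]
        split
        · exact fun m hm => convStar_mem_orderFiltration (s := s) hbo hΛo m (by omega)
        · exact hbo) (a := Pi.single 0 a) (fun m hm => absurd hm (by omega))
    simpa using this
  have hCo : ∀ n, C n ∈ orderFiltration K A n := by
    intro n
    have := gbrace_mem_filtration (s := convStar s) (F := orderFiltration K A)
      convStar_mem_orderFiltration (n := n) (k := 0)
      (b := fun _ => b) (w := fun _ => 1) (fun j => hbo)
      (a := Pi.single 0 a) (fun m hm => absurd hm (by omega))
    simpa using this
  have hfac : ∀ n : ℕ, ((n.factorial : ℕ) : K) ≠ 0 := fun n => by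
    exact_mod_cast n.factorial_ne_zero
  -- After division by factorials the `U` terms telescope, leaving a single one whose order in `t`
  -- is at least `M`.
  have htel : ∀ M, E (∑ n ∈ Finset.range (M + 1), (n.factorial : K)⁻¹ • C n) =
      convStar s (∑ n ∈ Finset.range M, (n.factorial : K)⁻¹ • C n) Λ +
        (M.factorial : K)⁻¹ • U M := by
    intro M
    induction M with
    | zero =>
      have : C 0 = Pi.single 0 a := rfl
      simp [this, hE0, hU]
    | succ M ih =>
      rw [Finset.sum_range_succ, map_add, ih, Finset.sum_range_succ _ M, map_add,
        LinearMap.add_apply, map_smul, map_smul, hEC, LinearMap.smul_apply, smul_add, smul_smul]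
      have h1 : (((M + 1).factorial : ℕ) : K)⁻¹ * ((M : K) + 1) = ((M.factorial : ℕ) : K)⁻¹ := by
        have h2 : (M : K) + 1 ≠ 0 := by exact_mod_cast M.succ_ne_zero
        rw [Nat.factorial_succ]
        push_cast
        rw [mul_inv, mul_comm, ← mul_assoc, mul_inv_cancel₀ h2, one_mul]
      rw [h1, smul_sub]
      abel
  have hstable : ∀ N M, N + 1 ≤ M → (∑ n ∈ Finset.range M, (n.factorial : K)⁻¹ • C n) N =
      ∑ n ∈ Finset.range (N + 1), (n.factorial : K)⁻¹ • C n N := by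
    intro N M hM
    rw [Finset.sum_apply]
    symm
    refine Finset.sum_subset (Finset.range_subset_range.mpr hM) fun n _ hn => ?_
    rw [hCo n N (by simpa using hn), smul_zero]
  change ∑ n ∈ Finset.range (N + 1), (n.factorial : K)⁻¹ • C n N = _
  induction N with
  | zero => simp [hC, gbrace]
  | succ N ih =>
    -- Cutting at `N + 2` pushes the remaining `U` term beyond the coefficient of `t^{N+1}`.
    have h1 := congrFun (htel (N + 2)) (N + 1)
    rw [eulerSeries_apply, hstable _ _ (by omega), Pi.add_apply, Pi.smul_apply,
      hUo (N + 2) (N + 1) (by omega), smul_zero, add_zero, hΛ, convStar_single_succ,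
      hstable _ _ (by omega), ih] at h1
    have h2 : ((N + 1 : ℕ) : K) ≠ 0 := by exact_mod_cast N.succ_ne_zero
    have h3 := congrArg (fun v => ((N + 1 : ℕ) : K)⁻¹ • v) h1
    simp only [smul_smul, inv_mul_cancel₀ h2, one_smul] at h3
    rw [h3, pow_succ', Nat.factorial_succ]
    simp only [map_smul, LinearMap.smul_apply, smul_smul, Module.End.mul_apply,
      LinearMap.flip_apply]
    push_cast
    rw [mul_inv]

/-- Power series `f` with `f n` of weight at least `n`, paired with the value of their sum. -/
def evalRel (F : ℕ → Submodule K A) : AddSubgroup ((ℕ → A) × A) where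
  carrier := {p | (∀ n, p.1 n ∈ F n) ∧ ∀ m, ∑ n ∈ Finset.range m, p.1 n - p.2 ∈ F m}
  add_mem' {p q} hp hq := ⟨fun n => (F n).add_mem (hp.1 n) (hq.1 n), fun m => by
    have := (F m).add_mem (hp.2 m) (hq.2 m)
    simpa [Finset.sum_add_distrib, add_sub_add_comm] using this⟩
  zero_mem' := ⟨fun n => (F n).zero_mem, fun m => by simp⟩
  neg_mem' {p} hp := ⟨fun n => (F n).neg_mem (hp.1 n), fun m => by
    have := (F m).neg_mem (hp.2 m)
    simp only [Prod.fst_neg, Prod.snd_neg, Pi.neg_apply, Finset.sum_neg_distrib]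
    rwa [← neg_sub']⟩

end Convolution

/-! ### Compatibility of products with summation at `t = 1` -/

section SumsOfPowerSeries

variable {K : Type*} {A : Type*} [Field K] [AddCommGroup A] [Module K A]

/-- The product of the partial sums approximates `s x y` modulo `F m`, and differs from the partial
sum of the convolution by terms with `i + j ≥ m`, which lie in `F m`. -/
theorem convStar_mem_evalRel {s : A →ₗ[K] A →ₗ[K] A} {F : ℕ → Submodule K A} (hF : Antitone F)
    (hF0 : F 0 = ⊤) (hs : ∀ {i j x y}, x ∈ F i → y ∈ F j → s x y ∈ F (i + j))
    {p q : (ℕ → A) × A} (hp : p ∈ evalRel F) (hq : q ∈ evalRel F) :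
    (convStar s p.1 q.1, s p.2 q.2) ∈ evalRel F := by
  obtain ⟨f, x⟩ := p
  obtain ⟨g, y⟩ := q
  obtain ⟨hf, hx⟩ := hp
  obtain ⟨hg, hy⟩ := hq
  simp only at hf hx hg hy ⊢
  refine ⟨fun n => ?_, fun m => ?_⟩
  · simp only [convStar_apply]
    refine Submodule.sum_mem _ fun ij hij => ?_
    rw [← Finset.HasAntidiagonal.mem_antidiagonal.mp hij]
    exact hs (hf _) (hg _)
  · have h1 : s (∑ i ∈ Finset.range m, f i) (∑ j ∈ Finset.range m, g j) - s x y ∈ F m := by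
      have ha := hs (hx m) (hF0 ▸ Submodule.mem_top : (∑ j ∈ Finset.range m, g j) ∈ F 0)
      have hb := hs (hF0 ▸ Submodule.mem_top : x ∈ F 0) (hy m)
      rw [zero_add] at hb
      have := (F m).add_mem ha hb
      simp only [map_sub, LinearMap.sub_apply] at this
      simpa using this
    have h2 : ∑ n ∈ Finset.range m, convStar s f g n =
        ∑ p ∈ (Finset.range m ×ˢ Finset.range m).filter (fun p => p.1 + p.2 < m),
          s (f p.1) (g p.2) := by
      rw [← Finset.sum_fiberwise_of_maps_to (g := fun p : ℕ × ℕ => p.1 + p.2)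
        (t := Finset.range m) (fun p hp => by simpa using (Finset.mem_filter.mp hp).2)]
      refine Finset.sum_congr rfl fun n hn => ?_
      rw [convStar_apply]
      refine Finset.sum_congr ?_ fun _ _ => rfl
      ext ⟨i, j⟩
      simp only [Finset.HasAntidiagonal.mem_antidiagonal, Finset.mem_filter, Finset.mem_product,
        Finset.mem_range] at hn ⊢
      omega
    have h3 : s (∑ i ∈ Finset.range m, f i) (∑ j ∈ Finset.range m, g j) =
        ∑ p ∈ Finset.range m ×ˢ Finset.range m, s (f p.1) (g p.2) := by
      simp only [map_sum, LinearMap.sum_apply]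
      rw [Finset.sum_comm, Finset.sum_product]
    rw [h3, ← Finset.sum_filter_add_sum_filter_not _ (fun p => p.1 + p.2 < m), ← h2] at h1
    have h4 : ∑ p ∈ (Finset.range m ×ˢ Finset.range m).filter (fun p => ¬ p.1 + p.2 < m),
        s (f p.1) (g p.2) ∈ F m := by
      refine Submodule.sum_mem _ fun p hp => ?_
      exact hF (not_lt.mp (Finset.mem_filter.mp hp).2) (hs (hf _) (hg _))
    have := (F m).sub_mem h1 h4
    simp only
    convert this using 1
    abel

theorem gbrace_add (s : A →ₗ[K] A →ₗ[K] A) (n : ℕ) (b : Fin n → A) (a a' : A) :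
    gbrace s n b (a + a') = gbrace s n b a + gbrace s n b a' := by
  induction n with
  | zero => rfl
  | succ n ih =>
    simp only [gbrace, ih, map_add, LinearMap.add_apply, Finset.sum_add_distrib]
    abel

end SumsOfPowerSeries

/-! ### The weight filtration and convergence -/

namespace DGPreLie.WeightGrading

variable {K : Type*} {A : Type*} [Field K] [AddCommGroup A] [Module K A] {P : DGPreLie K A}

/-- The elements of weight at least `p`. -/
def fil (W : P.WeightGrading) (p : ℕ) : Submodule K A where
  carrier := {x | ∀ n < p, W.wt n x = 0}
  add_mem' hx hy n hn := by rw [map_add, hx n hn, hy n hn, add_zero]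
  zero_mem' n _ := map_zero _
  smul_mem' c x hx n hn := by rw [map_smul, hx n hn, smul_zero]

variable (W : P.WeightGrading)

theorem mem_fil {p : ℕ} {x : A} : x ∈ W.fil p ↔ ∀ n < p, W.wt n x = 0 := Iff.rfl

theorem fil_antitone : Antitone W.fil := fun _ _ h _ hx n hn => hx n (hn.trans_le h)

theorem fil_zero : W.fil 0 = ⊤ := eq_top_iff.mpr fun _ _ n hn => absurd hn (Nat.not_lt_zero n)

theorem mem_fil_zero (x : A) : x ∈ W.fil 0 := by rw [fil_zero]; trivial

theorem star_mem_fil {i j : ℕ} {x y : A} (hx : x ∈ W.fil i) (hy : y ∈ W.fil j) :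
    P.star x y ∈ W.fil (i + j) := by
  intro n hn
  rw [W.wt_star]
  refine Finset.sum_eq_zero fun ij hij => ?_
  rw [Finset.HasAntidiagonal.mem_antidiagonal] at hij
  rcases Nat.lt_or_ge ij.1 i with h | h
  · rw [hx _ h, map_zero, LinearMap.zero_apply]
  · rw [hy ij.2 (by omega), map_zero]

theorem d_mem_fil {p : ℕ} {x : A} (hx : x ∈ W.fil p) : P.d x ∈ W.fil p := W.wt_d p x hx

theorem mem_g {k : ℤ} {x : A} : x ∈ W.g k ↔ x ∈ P.deg k ∧ x ∈ W.fil 1 := by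
  simp [g, mem_fil]

theorem eq_zero_of_mem_fil {x : A} (h : ∀ p, x ∈ W.fil p) : x = 0 :=
  W.wt_separated x fun n => h (n + 1) n n.lt_succ_self

theorem eq_of_sub_mem_fil {x y : A} (h : ∀ p, x - y ∈ W.fil p) : x = y :=
  sub_eq_zero.mp (W.eq_zero_of_mem_fil h)

theorem HasWSum.unique {W : P.WeightGrading} {f : ℕ → A} {x y : A} (hx : W.HasWSum f x)
    (hy : W.HasWSum f y) : x = y := by
  refine sub_eq_zero.mp (W.wt_separated _ fun n => ?_)
  obtain ⟨N, h1, h2⟩ := ((hx n).and (hy n)).exists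
  rw [map_sub, ← h1, ← h2, sub_self]

theorem HasWSum.wsum_eq {W : P.WeightGrading} {f : ℕ → A} {x : A} (hx : W.HasWSum f x) :
    W.wsum f = x := by
  have h : ∃ x, W.HasWSum f x := ⟨x, hx⟩
  rw [wsum, dif_pos h]
  exact h.choose_spec.unique hx

theorem hasWSum_of_mem_evalRel {f : ℕ → A} {x : A} (h : (f, x) ∈ evalRel W.fil) :
    W.HasWSum f x := by
  intro n
  filter_upwards [Filter.eventually_ge_atTop (n + 1)] with N hN
  rw [← sub_eq_zero, ← map_sub]
  exact h.2 N n (by omega)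

theorem wsum_eq_of_mem_evalRel {f : ℕ → A} {x : A} (h : (f, x) ∈ evalRel W.fil) :
    W.wsum f = x := (W.hasWSum_of_mem_evalRel h).wsum_eq

/-- Terms past the `n`-th have no component of weight `n`, so each weight of the sum is read off a
finite partial sum. Completeness holds only within one degree, hence the fixed `k`. -/
theorem exists_mem_evalRel {k : ℤ} {f : ℕ → A} (hk : ∀ n, f n ∈ P.deg k)
    (hf : ∀ n, f n ∈ W.fil n) : ∃ x ∈ P.deg k, (f, x) ∈ evalRel W.fil := by
  obtain ⟨x, hx, hw⟩ := W.wt_complete k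
    (fun n => W.wt n (∑ i ∈ Finset.range (n + 1), f i))
    (fun n => W.wt_mem n (Submodule.sum_mem _ fun i _ => hk i))
    (fun n => by rw [W.wt_wt, if_pos rfl])
  refine ⟨x, hx, hf, fun m n hn => ?_⟩
  have h0 : ∀ i ∈ Finset.range m, i ∉ Finset.range (n + 1) → W.wt n (f i) = 0 := fun i _ hi =>
    hf i n (by simpa using hi)
  rw [map_sub, hw, map_sum, map_sum, sub_eq_zero]
  exact (Finset.sum_subset (Finset.range_subset_range.mpr hn) h0).symm

theorem sum_sub_mem_fil {f : ℕ → A} {x : A} (h : (f, x) ∈ evalRel W.fil) {p m : ℕ} (hpm : p ≤ m) :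
    ∑ i ∈ Finset.range m, f i - x ∈ W.fil p := W.fil_antitone hpm (h.2 m)

theorem star_mem_deg_zero {k : ℤ} {x y : A} (hx : x ∈ P.deg k) (hy : y ∈ P.deg 0) :
    P.star x y ∈ P.deg k := by simpa using P.star_mem hx hy

theorem rightSymmetricOn_deg_zero : RightSymmetricOn P.star (P.deg 0) where
  mul_mem hx hy := star_mem_deg_zero hx hy
  symm x y z hy hz := by simpa using P.star_preLie x hy hz

theorem starPow_mem_deg {l : A} (hl : l ∈ P.deg 0) (n : ℕ) : P.starPow l n ∈ P.deg 0 := by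
  induction n with
  | zero => exact P.one_mem
  | succ n ih => exact star_mem_deg_zero ih hl

theorem starPow_mem_fil {l : A} (hl : l ∈ W.fil 1) (n : ℕ) : P.starPow l n ∈ W.fil n := by
  induction n with
  | zero => exact W.mem_fil_zero _
  | succ n ih => exact W.star_mem_fil ih hl

theorem starPow_eq_pow_apply (l : A) (n : ℕ) :
    P.starPow l n = ((P.star.flip l) ^ n) P.one := by
  induction n with
  | zero => rfl
  | succ n ih => rw [starPow, ih, pow_succ']; rfl

variable {W}

theorem expTerm_mem_evalRel {l : A} (hl : l ∈ W.g 0) : (expTerm P l, W.exp l) ∈ evalRel W.fil := by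
  obtain ⟨hl0, hl1⟩ := W.mem_g.mp hl
  obtain ⟨x, -, hx⟩ := W.exists_mem_evalRel (f := expTerm P l) (k := 0)
    (fun n => Submodule.smul_mem _ _ (starPow_mem_deg hl0 n))
    (fun n => Submodule.smul_mem _ _ (W.starPow_mem_fil hl1 n))
  rwa [exp, W.wsum_eq_of_mem_evalRel hx]

theorem exp_mem_deg {l : A} (hl : l ∈ W.g 0) : W.exp l ∈ P.deg 0 := by
  obtain ⟨hl0, hl1⟩ := W.mem_g.mp hl
  obtain ⟨x, hx0, hx⟩ := W.exists_mem_evalRel (f := expTerm P l) (k := 0)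
    (fun n => Submodule.smul_mem _ _ (starPow_mem_deg hl0 n))
    (fun n => Submodule.smul_mem _ _ (W.starPow_mem_fil hl1 n))
  rwa [exp, W.wsum_eq_of_mem_evalRel hx]

theorem expTerm_zero (l : A) : expTerm P l 0 = P.one := by simp [expTerm, starPow]

theorem exp_sub_one_mem_g {l : A} (hl : l ∈ W.g 0) : W.exp l - P.one ∈ W.g 0 := by
  refine W.mem_g.mpr ⟨Submodule.sub_mem _ (exp_mem_deg hl) P.one_mem, ?_⟩
  have h := (expTerm_mem_evalRel hl).2 1
  simp only [Finset.sum_range_one, expTerm_zero] at h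
  rw [← neg_sub]
  exact Submodule.neg_mem _ h

theorem circTerm_mem_fil (a : A) {u : A} (hu : u - P.one ∈ W.g 0) (n : ℕ) :
    circTerm P a u n ∈ W.fil n := by
  refine Submodule.smul_mem _ _ ?_
  rw [brace_eq_gbrace]
  simpa using gbrace_mem_filtration (s := P.star) (F := W.fil) W.star_mem_fil (n := n) (k := 0)
    (b := fun _ => u - P.one) (w := fun _ => 1) (fun _ => (W.mem_g.mp hu).2) (W.mem_fil_zero a)

theorem circTerm_add (a a' u : A) :
    circTerm P (a + a') u = circTerm P a u + circTerm P a' u := by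
  ext n
  simp [circTerm, brace_eq_gbrace, gbrace_add]

theorem circTerm_mem_evalRel (a : A) {u : A} (hu : u - P.one ∈ W.g 0) :
    (circTerm P a u, W.circ a u) ∈ evalRel W.fil := by
  suffices h : ∃ x, (circTerm P a u, x) ∈ evalRel W.fil by
    obtain ⟨x, hx⟩ := h
    rwa [circ, W.wsum_eq_of_mem_evalRel hx]
  -- Completeness is degreewise, so `a` is split into homogeneous parts; the terms are additive in
  -- `a`.
  have ha : a ∈ ⨆ k, P.deg k := by rw [P.deg_internal.submodule_iSup_eq_top]; trivial
  induction ha using Submodule.iSup_induction' with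
  | mem k a ha =>
    obtain ⟨x, -, hx⟩ := W.exists_mem_evalRel (f := circTerm P a u) (k := k) (fun n => by
      refine Submodule.smul_mem _ _ ?_
      rw [brace_eq_gbrace]
      exact gbrace_mem_of_mul_mem (B := P.deg 0) star_mem_deg_zero star_mem_deg_zero
        (fun _ => (W.mem_g.mp hu).1) ha) (circTerm_mem_fil a hu)
    exact ⟨x, hx⟩
  | zero =>
    have h0 : circTerm P 0 u = 0 := by
      have := circTerm_add (P := P) 0 0 u
      simpa using this
    exact ⟨0, by rw [h0]; exact AddSubgroup.zero_mem _⟩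
  | add a a' _ _ h h' =>
    obtain ⟨x, hx⟩ := h
    obtain ⟨x', hx'⟩ := h'
    exact ⟨x + x', by rw [circTerm_add]; exact AddSubgroup.add_mem _ hx hx'⟩

theorem smul_star_expTerm [CharZero K] (l : A) (n : ℕ) :
    ((n : K) + 1) • expTerm P l (n + 1) = P.star (expTerm P l n) l := by
  have h : (n : K) + 1 ≠ 0 := by exact_mod_cast n.succ_ne_zero
  simp only [expTerm, starPow, map_smul, LinearMap.smul_apply, smul_smul]
  congr 1
  rw [Nat.factorial_succ]
  push_cast
  rw [mul_inv, ← mul_assoc, mul_inv_cancel₀ h, one_mul]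

/-- The circle product with `eˡ` is the exponential of right multiplication by `l`. -/
theorem sum_sub_circ_exp_mem_fil [CharZero K] {l : A} (hl : l ∈ W.g 0) (a : A) {p m : ℕ}
    (hpm : p ≤ m) :
    ∑ n ∈ Finset.range m, (n.factorial : K)⁻¹ • ((P.star.flip l) ^ n) a - W.circ a (W.exp l) ∈
      W.fil p := by
  refine W.fil_antitone hpm ?_
  obtain ⟨hl0, hl1⟩ := W.mem_g.mp hl
  -- The coefficients of `e^{tl} - 1`.
  set b : ℕ → A := fun n => if n = 0 then 0 else expTerm P l n with hb
  have hb1 : b 1 = l := by simp [hb, expTerm, starPow, P.one_star]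
  have hbE : (b, W.exp l - P.one) ∈ evalRel W.fil := by
    have h1 : ((Pi.single 0 P.one : ℕ → A), P.one) ∈ evalRel W.fil := by
      refine ⟨fun n => ?_, fun n => ?_⟩
      · rcases n with _ | n
        · exact W.mem_fil_zero _
        · simp
      · rcases n with _ | n
        · exact W.mem_fil_zero _
        · simp
    have h2 := AddSubgroup.sub_mem _ (expTerm_mem_evalRel hl) h1
    convert h2 using 1
    rw [Prod.mk_sub_mk]
    congr 1
    ext n
    rcases n with _ | n
    · simp [hb, expTerm_zero]
    · simp [hb]
  have haE : ((Pi.single 0 a : ℕ → A), a) ∈ evalRel W.fil := by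
    refine ⟨fun n => ?_, fun n => ?_⟩
    · rcases n with _ | n
      · exact W.mem_fil_zero _
      · simp
    · rcases n with _ | n
      · exact W.mem_fil_zero _
      · simp
  have hrel : ∀ n, (gbrace (convStar P.star) n (fun _ => b) (Pi.single 0 a),
      gbrace P.star n (fun _ => W.exp l - P.one) a) ∈ evalRel W.fil := fun n =>
    gbrace_rel _ (convStar_mem_evalRel W.fil_antitone W.fil_zero W.star_mem_fil)
      (fun _ => hbE) haE
  have hord : ∀ n, gbrace (convStar P.star) n (fun _ => b) (Pi.single 0 a) ∈
      orderFiltration K A n := by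
    intro n
    have := gbrace_mem_filtration (s := convStar P.star) (F := orderFiltration K A)
      convStar_mem_orderFiltration (n := n) (k := 0)
      (b := fun _ => b) (w := fun _ => 1)
      (fun j m hm => by rw [Nat.lt_one_iff.mp hm]; simp [hb])
      (a := Pi.single 0 a) (fun m hm => absurd hm (by omega))
    simpa using this
  have hcoef : ∀ N < m, ∑ n ∈ Finset.range m,
      (n.factorial : K)⁻¹ • gbrace (convStar P.star) n (fun _ => b) (Pi.single 0 a) N =
      (N.factorial : K)⁻¹ • ((P.star.flip l) ^ N) a := by
    intro N hN
    rw [← sum_gbrace_convStar_exp rightSymmetricOn_deg_zero hl0 (by simp [hb]) hb1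
      (fun n => by
        have := smul_star_expTerm (P := P) l (n + 1)
        simp only [hb, Nat.succ_ne_zero, if_false]
        rw [← this]
        push_cast
        congr 1
        ring) a N]
    symm
    refine Finset.sum_subset (Finset.range_subset_range.mpr hN) fun n _ hn => ?_
    rw [hord n N (by simpa using hn), smul_zero]
  have h1 := (circTerm_mem_evalRel a (exp_sub_one_mem_g hl)).2 m
  -- Modulo weight `m`, each brace of `e^l - 1` may be replaced by the partial sum at `t = 1` of the
  -- brace of power series; interchanging the sums then brings in `hcoef`.
  have h2 : ∑ n ∈ Finset.range m, (n.factorial : K)⁻¹ •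
      (∑ N ∈ Finset.range m, gbrace (convStar P.star) n (fun _ => b) (Pi.single 0 a) N -
        gbrace P.star n (fun _ => W.exp l - P.one) a) ∈ W.fil m :=
    Submodule.sum_mem _ fun n _ => Submodule.smul_mem _ _ ((hrel n).2 m)
  have h3 := Submodule.add_mem _ h2 h1
  simp only [circTerm, brace_eq_gbrace, smul_sub, Finset.sum_sub_distrib] at h3
  rw [sub_add_sub_cancel] at h3
  simp only [Finset.smul_sum] at h3
  rwa [Finset.sum_comm, Finset.sum_congr rfl fun N hN => hcoef N (Finset.mem_range.mp hN)] at h3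

end DGPreLie.WeightGrading

/-! ### Injectivity of the exponential on nilpotent elements -/

section NilpotentLog

/-- Both elements equal the logarithm series evaluated at the common value of `exp - 1`. -/
theorem IsNilpotent.exp_injective {S : Type*} [Ring S] [Algebra ℚ S] {x y : S}
    (hx : IsNilpotent x) (hy : IsNilpotent y) (h : IsNilpotent.exp x = IsNilpotent.exp y) :
    x = y := by
  obtain ⟨m, hm⟩ := IsNilpotent.isNilpotent_exp_sub_one hx
  have key : ∀ z : S, IsNilpotent z → IsNilpotent.exp z = IsNilpotent.exp x →
      z = PowerSeries.nilEval hm (PowerSeries.log ℚ) := by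
    rintro z ⟨n, hn⟩ hz
    have he : PowerSeries.nilEval hn (PowerSeries.exp ℚ - 1) = IsNilpotent.exp x - 1 := by
      rw [map_sub, map_one, PowerSeries.nilEval_exp, hz]
    have h1 := PowerSeries.nilEval_subst hn PowerSeries.HasSubst.exp_sub_one
      (by rw [he]; exact hm) (PowerSeries.log ℚ)
    rw [PowerSeries.log_subst_exp_sub_one, PowerSeries.nilEval_X] at h1
    rw [h1]
    simp only [PowerSeries.nilEval_apply, he]
  rw [key x hx rfl, ← key y hy h.symm]

theorem exp_commOp_apply_eq_sum {S : Type*} [Ring S] [Algebra ℚ S] {z : S} {n : ℕ}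
    (hn : commOp z ^ n = 0) {T : ℕ → S} (hT : ∀ i, commOp z (T i) = T (i + 1)) :
    IsNilpotent.exp (commOp z) (T 0) = ∑ i ∈ Finset.range n, (i.factorial : ℚ)⁻¹ • T i := by
  have h : ∀ i, (commOp z ^ i) (T 0) = T i := by
    intro i
    induction i with
    | zero => rfl
    | succ i ih => rw [pow_succ', Module.End.mul_apply, ih, hT]
  rw [IsNilpotent.exp_eq_sum hn]
  simp [h]

end NilpotentLog

/-! ### Right multiplications and the differential as operators -/

namespace DGPreLie

variable {K : Type*} {A : Type*} [Field K] [AddCommGroup A] [Module K A] (P : DGPreLie K A)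

theorem linearMap_ext_deg {M : Type*} [AddCommGroup M] [Module K M] {f g : A →ₗ[K] M}
    (h : ∀ k, ∀ x ∈ P.deg k, f x = g x) : f = g := by
  ext a
  have ha : a ∈ ⨆ k, P.deg k := by rw [P.deg_internal.submodule_iSup_eq_top]; trivial
  induction ha using Submodule.iSup_induction' with
  | mem k a ha => exact h k a ha
  | zero => simp
  | add a b _ _ ha hb => rw [map_add, map_add, ha, hb]

/-- The operator `(-1)^k` on elements of degree `k`. -/
noncomputable def signOp : A →ₗ[K] A :=
  DirectSum.toModule K ℤ A (fun k => ((k.negOnePow : ℤˣ) : ℤ) • (P.deg k).subtype) ∘ₗ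
    (LinearEquiv.ofBijective (DirectSum.coeLinearMap P.deg) P.deg_internal).symm.toLinearMap

variable {P}

theorem signOp_apply {k : ℤ} {x : A} (hx : x ∈ P.deg k) : P.signOp x = k.negOnePow • x := by
  have h : (LinearEquiv.ofBijective (DirectSum.coeLinearMap P.deg) P.deg_internal).symm x =
      DirectSum.lof K ℤ (fun k => P.deg k) k ⟨x, hx⟩ := by
    rw [LinearEquiv.symm_apply_eq]
    exact (DirectSum.coeLinearMap_lof P.deg k ⟨x, hx⟩).symm
  rw [signOp, LinearMap.comp_apply, LinearEquiv.coe_coe, h, DirectSum.toModule_lof]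
  rfl

variable (P) in
/-- The differential with the sign `(-1)^k` on elements of degree `k`. -/
noncomputable def signedD : A →ₗ[K] A := P.d ∘ₗ P.signOp

theorem signedD_apply {k : ℤ} {x : A} (hx : x ∈ P.deg k) : P.signedD x = k.negOnePow • P.d x := by
  rw [signedD, LinearMap.comp_apply, signOp_apply hx, Units.smul_def, Units.smul_def, map_zsmul]

theorem signedD_signedD (x : A) : P.signedD (P.signedD x) = 0 := by
  have h : P.signedD ∘ₗ P.signedD = 0 := by
    refine P.linearMap_ext_deg fun k x hx => ?_
    rw [LinearMap.comp_apply, signedD_apply hx, Units.smul_def, map_zsmul,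
      signedD_apply (P.d_mem hx), P.d_d]
    simp
  exact LinearMap.congr_fun h x

/-- The twist absorbs the Koszul sign, which depends on the degree of `x`; the rule thus becomes
linear and extends from homogeneous `x` to all of `A`. -/
theorem signedD_star_deg_zero (x : A) {l : A} (hl : l ∈ P.deg 0) :
    P.signedD (P.star x l) = P.star (P.signedD x) l + P.star x (P.d l) := by
  have h : P.signedD ∘ₗ P.star.flip l = P.star.flip l ∘ₗ P.signedD + P.star.flip (P.d l) := by
    refine P.linearMap_ext_deg fun k x hx => ?_
    have hxl := P.star_mem hx hl
    rw [add_zero] at hxl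
    simp only [LinearMap.comp_apply, LinearMap.add_apply, LinearMap.flip_apply]
    rw [signedD_apply hxl, signedD_apply hx, P.d_star l hx, smul_add, smul_smul,
      Int.units_mul_self, one_smul]
    simp only [Units.smul_def, map_zsmul, LinearMap.smul_apply]
  exact LinearMap.congr_fun h x

theorem signedD_star_deg_neg_one (x : A) {a : A} (ha : a ∈ P.deg (-1)) :
    P.signedD (P.star x a) = -P.star (P.signedD x) a - P.star x (P.d a) := by
  have h : P.signedD ∘ₗ P.star.flip a =
      -(P.star.flip a ∘ₗ P.signedD) - P.star.flip (P.d a) := by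
    refine P.linearMap_ext_deg fun k x hx => ?_
    simp only [LinearMap.comp_apply, LinearMap.sub_apply, LinearMap.flip_apply,
      LinearMap.neg_apply]
    rw [signedD_apply (P.star_mem hx ha), signedD_apply hx, P.d_star a hx, smul_add, smul_smul,
      Int.negOnePow_add, Int.negOnePow_neg, Int.negOnePow_one, mul_neg, mul_one, Units.neg_smul,
      neg_mul, Int.units_mul_self, Units.neg_smul, one_smul]
    simp only [Units.smul_def, map_zsmul, LinearMap.smul_apply, sub_eq_add_neg]
  exact LinearMap.congr_fun h x

/-- For odd arguments the pre-Lie sign is `-1`, so the associator with `a` repeated is its own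
negative. -/
theorem star_star_self_of_deg_neg_one [CharZero K] (x : A) {a : A} (ha : a ∈ P.deg (-1)) :
    P.star (P.star x a) a = P.star x (P.star a a) := by
  have h := P.star_preLie x ha ha
  have h1 : ((-1 : ℤ) * -1).negOnePow = -1 := by simp
  rw [h1, Units.neg_smul, one_smul, eq_neg_iff_add_eq_zero, ← two_smul K] at h
  exact sub_eq_zero.mp ((smul_eq_zero.mp h).resolve_left two_ne_zero)

theorem star_star_sub_star_star {k : ℤ} (a : A) {x l : A} (hx : x ∈ P.deg k) (hl : l ∈ P.deg 0) :
    P.star (P.star a x) l - P.star (P.star a l) x = -P.star a (P.bracket 0 k l x) := by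
  have h := P.star_preLie a hx hl
  simp only [mul_zero, Int.negOnePow_zero, one_smul] at h
  simp only [bracket, zero_mul, Int.negOnePow_zero, one_smul, map_sub]
  rw [sub_eq_sub_iff_add_eq_add] at h
  rw [neg_sub, sub_eq_sub_iff_add_eq_add, h]
  abel

theorem adPlus_apply (l x : A) (c : K) :
    P.adPlus l (x, c) = (P.bracket 0 (-1) l x - c • P.d l, 0) := by
  simp [adPlus, bracketPlus]

theorem adPlus_smul_left (t : K) (l : A) (v : A × K) : P.adPlus (t • l) v = t • P.adPlus l v := by
  obtain ⟨x, c⟩ := v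
  simp only [adPlus_apply, bracket, Prod.smul_mk, smul_zero, map_smul, LinearMap.smul_apply,
    smul_sub, Units.smul_def]
  rw [smul_comm c t, smul_comm t ((Int.negOnePow _ : ℤˣ) : ℤ)]

theorem adPlus_smul (t : K) (l : A) (v : A × K) : P.adPlus l (t • v) = t • P.adPlus l v := by
  obtain ⟨x, c⟩ := v
  simp only [adPlus_apply, bracket, Prod.smul_mk, smul_zero, map_smul, LinearMap.smul_apply,
    smul_sub, Units.smul_def, smul_assoc]
  rw [smul_comm t ((Int.negOnePow _ : ℤˣ) : ℤ)]

theorem bracket_mem_deg {k : ℤ} {l x : A} (hl : l ∈ P.deg 0) (hx : x ∈ P.deg k) :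
    P.bracket 0 k l x ∈ P.deg k := by
  have h1 := P.star_mem hl hx
  have h2 := P.star_mem hx hl
  rw [zero_add] at h1
  rw [add_zero] at h2
  rw [bracket, Units.smul_def]
  exact Submodule.sub_mem _ h1 (zsmul_mem h2 _)

theorem nestedBracket_mem_deg {w : List A} (hw : ∀ a ∈ w, a ∈ P.deg 0) :
    P.nestedBracket w ∈ P.deg 0 := by
  induction w with
  | nil => exact Submodule.zero_mem _
  | cons a w ih =>
    cases w with
    | nil => exact hw a (by simp)
    | cons b w => exact bracket_mem_deg (hw a (by simp)) (ih fun c hc => hw c (by simp [hc]))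

namespace WeightGrading

variable (W : P.WeightGrading)

theorem bracket_mem_fil {k l : ℤ} {i j : ℕ} {x y : A} (hx : x ∈ W.fil i) (hy : y ∈ W.fil j) :
    P.bracket k l x y ∈ W.fil (i + j) := by
  rw [bracket, Units.smul_def]
  refine Submodule.sub_mem _ (W.star_mem_fil hx hy) (zsmul_mem ?_ _)
  rw [add_comm]
  exact W.star_mem_fil hy hx

theorem nestedBracket_mem_fil {w : List A} (hw : ∀ a ∈ w, a ∈ W.fil 1) :
    P.nestedBracket w ∈ W.fil w.length := by
  induction w with
  | nil => exact Submodule.zero_mem _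
  | cons a w ih =>
    cases w with
    | nil => exact hw a (by simp)
    | cons b w =>
      rw [List.length_cons, add_comm]
      exact W.bracket_mem_fil (hw a (by simp)) (ih fun c hc => hw c (by simp [hc]))

theorem signOp_mem_fil {p : ℕ} {x : A} (hx : x ∈ W.fil p) : P.signOp x ∈ W.fil p := by
  intro n hn
  have h : W.wt n ∘ₗ P.signOp = P.signOp ∘ₗ W.wt n := by
    refine P.linearMap_ext_deg fun k x hx => ?_
    rw [LinearMap.comp_apply, LinearMap.comp_apply, signOp_apply hx,
      signOp_apply (W.wt_mem n hx), Units.smul_def, Units.smul_def, map_zsmul]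
  have := LinearMap.congr_fun h x
  simpa [hx n hn] using this

/-- The operators on `A` that do not lower the weight. -/
def filEnd : Subalgebra K (Module.End K A) where
  carrier := {T | ∀ p, ∀ x ∈ W.fil p, T x ∈ W.fil p}
  mul_mem' hS hT p x hx := hS p _ (hT p x hx)
  add_mem' hS hT p x hx := Submodule.add_mem _ (hS p x hx) (hT p x hx)
  algebraMap_mem' c p x hx := by
    rw [Module.algebraMap_end_apply]
    exact Submodule.smul_mem _ _ hx

/-- The quotient of `A` by the elements of weight at least `p`. -/
def Trunc (p : ℕ) : Type _ := A ⧸ W.fil p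

instance (p : ℕ) : AddCommGroup (W.Trunc p) := inferInstanceAs (AddCommGroup (A ⧸ W.fil p))

instance (p : ℕ) : Module K (W.Trunc p) := inferInstanceAs (Module K (A ⧸ W.fil p))

/-- The truncation of `A` at weight `p`. -/
def trunc (p : ℕ) : A →ₗ[K] W.Trunc p := (W.fil p).mkQ

theorem trunc_surjective (p : ℕ) : Function.Surjective (W.trunc p) := (W.fil p).mkQ_surjective

theorem trunc_eq_trunc_iff {p : ℕ} {x y : A} : W.trunc p x = W.trunc p y ↔ x - y ∈ W.fil p :=
  Submodule.Quotient.eq _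

theorem trunc_eq_zero_iff {p : ℕ} {x : A} : W.trunc p x = 0 ↔ x ∈ W.fil p :=
  Submodule.Quotient.mk_eq_zero _

theorem trunc_end_ext {p : ℕ} {S T : Module.End K (W.Trunc p)}
    (h : ∀ x, S (W.trunc p x) = T (W.trunc p x)) : S = T := by
  refine LinearMap.ext fun y => ?_
  obtain ⟨x, rfl⟩ := W.trunc_surjective p y
  exact h x

/-- The action of `filEnd` on the truncation of `A` at weight `p`. -/
def toQuot (p : ℕ) : W.filEnd →ₐ[K] Module.End K (W.Trunc p) :=
  AlgHom.ofLinearMap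
    { toFun := fun T => (W.fil p).mapQ (W.fil p) T.1 (T.2 p)
      map_add' := fun _ _ => W.trunc_end_ext fun _ => rfl
      map_smul' := fun _ _ => W.trunc_end_ext fun _ => rfl }
    (W.trunc_end_ext fun _ => rfl) (fun _ _ => W.trunc_end_ext fun _ => rfl)

theorem toQuot_apply_trunc (p : ℕ) (T : W.filEnd) (x : A) :
    W.toQuot p T (W.trunc p x) = W.trunc p (T.1 x) := rfl

theorem toQuot_eq_zero {p : ℕ} {T : W.filEnd} (h : ∀ x, T.1 x ∈ W.fil p) : W.toQuot p T = 0 :=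
  W.trunc_end_ext fun x => W.trunc_eq_zero_iff.mpr (h x)

/-- Right multiplication. -/
def rightMul : A →ₗ[K] W.filEnd where
  toFun x := ⟨P.star.flip x, fun p y hy => by simpa using W.star_mem_fil hy (W.mem_fil_zero x)⟩
  map_add' x y := by ext; simp
  map_smul' c x := by ext; simp

theorem rightMul_apply (x a : A) : (W.rightMul x).1 a = P.star a x := rfl

/-- The operator of right multiplication by `x + c δ`. -/
noncomputable def rightMulPlus (v : A × K) : W.filEnd :=
  W.rightMul v.1 - v.2 • ⟨P.signedD, fun _ _ hx => W.d_mem_fil (W.signOp_mem_fil hx)⟩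

theorem rightMulPlus_apply (v : A × K) (a : A) :
    (W.rightMulPlus v).1 a = P.star a v.1 - v.2 • P.signedD a := rfl

theorem rightMulPlus_add (v w : A × K) :
    W.rightMulPlus (v + w) = W.rightMulPlus v + W.rightMulPlus w := by
  simp only [rightMulPlus, Prod.fst_add, Prod.snd_add, map_add, add_smul]
  abel

theorem rightMulPlus_smul (c : K) (v : A × K) :
    W.rightMulPlus (c • v) = c • W.rightMulPlus v := by
  simp only [rightMulPlus, Prod.smul_fst, Prod.smul_snd, map_smul, smul_sub, smul_assoc]

/-- For `v` in `g` this is the pre-Lie identity. For `δ` it is `[R_l, -signedD] = R_{dl}`, matching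
`ad_l δ = -dl`; this dictates the sign in `rightMulPlus`. -/
theorem commutator_rightMul_rightMulPlus {l : A} (hl : l ∈ P.deg 0) {v : A × K}
    (hv : v.1 ∈ P.deg (-1)) :
    W.rightMul l * W.rightMulPlus v - W.rightMulPlus v * W.rightMul l =
      -W.rightMulPlus (P.adPlus l v) := by
  obtain ⟨x, c⟩ := v
  ext a
  change P.star (P.star a x - c • P.signedD a) l -
    (P.star (P.star a l) x - c • P.signedD (P.star a l)) =
    -(P.star a (P.adPlus l (x, c)).1 - (P.adPlus l (x, c)).2 • P.signedD a)
  have h := star_star_sub_star_star a hv hl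
  rw [adPlus_apply, signedD_star_deg_zero a hl]
  simp only [map_sub, map_smul, LinearMap.sub_apply, LinearMap.smul_apply, smul_add, zero_smul,
    sub_zero]
  rw [neg_sub, sub_eq_iff_eq_add] at *
  rw [h]
  abel

theorem commutator_rightMul {k : ℤ} {l x : A} (hl : l ∈ P.deg 0) (hx : x ∈ P.deg k) :
    W.rightMul l * W.rightMul x - W.rightMul x * W.rightMul l =
      -W.rightMul (P.bracket 0 k l x) := by
  ext a
  exact star_star_sub_star_star a hx hl

/-- The Maurer-Cartan equation for `α` says that `δ + α` squares to zero. -/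
theorem rightMulPlus_mul_self [CharZero K] {α : A} (hα : α ∈ P.deg (-1)) :
    W.rightMulPlus (α, 1) * W.rightMulPlus (α, 1) =
      W.rightMul (P.d α + (2 : K)⁻¹ • P.bracket (-1) (-1) α α) := by
  have hb : (2 : K)⁻¹ • P.bracket (-1) (-1) α α = P.star α α := by
    have : P.bracket (-1) (-1) α α = (2 : K) • P.star α α := by
      simp [bracket, Units.neg_smul, two_smul]
    rw [this, smul_smul, inv_mul_cancel₀ two_ne_zero, one_smul]
  rw [hb]
  ext a
  change P.star (P.star a α - (1 : K) • P.signedD a) α -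
    (1 : K) • P.signedD (P.star a α - (1 : K) • P.signedD a) = P.star a (P.d α + P.star α α)
  simp only [one_smul, map_sub, LinearMap.sub_apply, signedD_signedD,
    signedD_star_deg_neg_one a hα, star_star_self_of_deg_neg_one a hα, map_add]
  abel

theorem signedD_one : P.signedD P.one = 0 := by
  rw [signedD_apply P.one_mem, P.d_one, smul_zero]

/-- Right multiplication is faithful, as seen on the left unit. -/
theorem mem_MC_iff [CharZero K] {α : A} : α ∈ W.MC ↔
    α ∈ W.g (-1) ∧ W.rightMulPlus (α, 1) * W.rightMulPlus (α, 1) = 0 := by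
  refine and_congr_right fun hα => ?_
  rw [W.rightMulPlus_mul_self (W.mem_g.mp hα).1]
  constructor
  · intro h; rw [h, map_zero]
  · intro h
    have := congrArg (fun T : W.filEnd => T.1 P.one) h
    simpa [rightMul_apply, P.one_star] using this

end WeightGrading

end DGPreLie

/-! ### The gauge action as conjugation, modulo weight `p` -/

namespace DGPreLie.WeightGrading

variable {K : Type*} {A : Type*} [Field K] [AddCommGroup A] [Module K A] {P : DGPreLie K A}

theorem adPlus_iterate_mem {W : P.WeightGrading} {l : A} (hl : l ∈ W.g 0) {x : A} {c : K} (hx : x ∈ P.deg (-1))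
    (n : ℕ) : ((P.adPlus l)^[n] (x, c)).1 ∈ P.deg (-1) := by
  induction n with
  | zero => exact hx
  | succ n ih =>
    rw [Function.iterate_succ_apply']
    generalize (P.adPlus l)^[n] (x, c) = v at ih ⊢
    rw [adPlus_apply l v.1 v.2]
    exact Submodule.sub_mem _ (bracket_mem_deg (W.mem_g.mp hl).1 ih)
      (Submodule.smul_mem _ _ (by simpa using P.d_mem (W.mem_g.mp hl).1))

theorem adPlus_iterate_snd (l : A) (v : A × K) (n : ℕ) :
    ((P.adPlus l)^[n + 1] v).2 = 0 := by
  rw [Function.iterate_succ_apply']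
  obtain ⟨y, e⟩ := (P.adPlus l)^[n] v
  rw [adPlus_apply]

/-- Bracketing with `l` raises the weight. The term `dl` appears only in the first step, where
weight 1 suffices, since afterwards the coefficient of `δ` is 0. -/
theorem adPlus_iterate_mem_fil {W : P.WeightGrading} {l : A} (hl : l ∈ W.g 0) (v : A × K)
    (n : ℕ) : ((P.adPlus l)^[n] v).1 ∈ W.fil n := by
  induction n with
  | zero => exact W.mem_fil_zero _
  | succ n ih =>
    have h2 : n = 0 ∨ ((P.adPlus l)^[n] v).2 = 0 := by
      rcases n with _ | n
      · exact Or.inl rfl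
      · exact Or.inr (adPlus_iterate_snd l v n)
    rw [Function.iterate_succ_apply']
    generalize (P.adPlus l)^[n] v = w at ih h2 ⊢
    rw [adPlus_apply l w.1 w.2, add_comm]
    refine Submodule.sub_mem _ (W.bracket_mem_fil (W.mem_g.mp hl).2 ih) ?_
    rcases h2 with rfl | h2
    · exact Submodule.smul_mem _ _ (W.d_mem_fil (W.mem_g.mp hl).2)
    · rw [h2, zero_smul]
      exact Submodule.zero_mem _

theorem expAdTerm_mem_evalRel {W : P.WeightGrading} {l α : A} (hl : l ∈ W.g 0)
    (hα : α ∈ W.g (-1)) :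
    W.gauge l α ∈ W.g (-1) ∧ ((fun n => (expAdTerm P l α n).1), W.gauge l α) ∈ evalRel W.fil := by
  obtain ⟨x, hx1, hx⟩ := W.exists_mem_evalRel (f := fun n => (expAdTerm P l α n).1) (k := -1)
    (fun n => Submodule.smul_mem _ _ (adPlus_iterate_mem hl (W.mem_g.mp hα).1 n))
    (fun n => Submodule.smul_mem _ _ (adPlus_iterate_mem_fil hl _ n))
  have hg : W.gauge l α = x := W.wsum_eq_of_mem_evalRel hx
  rw [hg]
  refine ⟨W.mem_g.mpr ⟨hx1, ?_⟩, hx⟩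
  have h := hx.2 1
  simp only [Finset.sum_range_one, expAdTerm, Nat.factorial_zero, Nat.cast_one, inv_one, one_smul,
    Function.iterate_zero, id_eq] at h
  have := Submodule.sub_mem _ (W.mem_g.mp hα).2 h
  rwa [sub_sub_cancel] at this

variable (W : P.WeightGrading)

/-- The representation `l ↦ (a ↦ - a ⋆ l)` modulo weight `p`. -/
def rho (p : ℕ) : A →ₗ[K] Module.End K (W.Trunc p) :=
  -((W.toQuot p).toLinearMap ∘ₗ W.rightMul)

theorem rho_apply (p : ℕ) (l : A) : W.rho p l = -W.toQuot p (W.rightMul l) := rfl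

variable {W}

theorem rho_one (p : ℕ) (l : A) : W.rho p l (W.trunc p P.one) = -W.trunc p l := by
  rw [rho_apply, LinearMap.neg_apply, toQuot_apply_trunc, rightMul_apply, P.one_star]

theorem inv_factorial_smul {M : Type*} [AddCommGroup M] [Module K M] [Module ℚ M] (n : ℕ) (x : M) :
    (n.factorial : ℚ)⁻¹ • x = (n.factorial : K)⁻¹ • x := inv_natCast_smul_eq ℚ K n.factorial x

theorem eq_of_trunc_eq {x y : A} (h : ∀ p, W.trunc p x = W.trunc p y) : x = y :=
  W.eq_of_sub_mem_fil fun p => W.trunc_eq_trunc_iff.mp (h p)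

theorem sum_expAdTerm_snd (l α : A) {m : ℕ} (hm : 1 ≤ m) :
    ∑ n ∈ Finset.range m, (expAdTerm P l α n).2 = 1 := by
  obtain ⟨m, rfl⟩ := Nat.exists_eq_add_of_le' hm
  rw [Finset.sum_range_succ', Finset.sum_eq_zero]
  · simp [expAdTerm]
  · intro n _
    rw [expAdTerm, Prod.smul_snd, adPlus_iterate_snd, smul_zero]

theorem toQuot_rightMulPlus_one (p : ℕ) (x : A) (c : K) :
    W.toQuot p (W.rightMulPlus (x, c)) (W.trunc p P.one) = W.trunc p x := by
  rw [toQuot_apply_trunc, rightMulPlus_apply, signedD_one, smul_zero, sub_zero, P.one_star]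

theorem eq_of_toQuot_rightMulPlus_eq {x y : A} {c e : K}
    (h : ∀ p, W.toQuot p (W.rightMulPlus (x, c)) = W.toQuot p (W.rightMulPlus (y, e))) : x = y :=
  eq_of_trunc_eq (W := W) fun p => by
    rw [← toQuot_rightMulPlus_one p x c, h p, toQuot_rightMulPlus_one]

theorem eq_zero_of_toQuot_eq_zero {T : W.filEnd} (h : ∀ p, W.toQuot p T = 0) : T = 0 := by
  ext a
  refine W.eq_zero_of_mem_fil fun p => W.trunc_eq_zero_iff.mp ?_
  have := congrArg (fun S : Module.End K (W.Trunc p) => S (W.trunc p a)) (h p)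
  exact this

/-- The minus sign in `rho` turns the bracket-reversing right multiplication into a Lie
representation. -/
theorem rho_nestedBracket {p : ℕ} {w : List A} (hw : ∀ a ∈ w, a ∈ P.deg 0) :
    W.rho p (P.nestedBracket w) = nestedComm (w.map (W.rho p)) := by
  induction w with
  | nil => simp [nestedBracket, nestedComm]
  | cons a w ih =>
    cases w with
    | nil => rfl
    | cons b w =>
      have h1 := ih fun c hc => hw c (by simp [hc])
      have hc := congrArg (W.toQuot p) (W.commutator_rightMul (hw a (by simp))
        (nestedBracket_mem_deg fun c hc => hw c (List.mem_cons_of_mem _ hc)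
          : P.nestedBracket (b :: w) ∈ P.deg 0))
      rw [map_sub, map_mul, map_mul, map_neg] at hc
      rw [List.map_cons, nestedComm_cons _ (by simp), ← h1, nestedBracket, rho_apply, ← hc, rho_apply, rho_apply]
      simp

section CharZero

variable [CharZero K] (W)

/-- The nilpotent exponential and the associative formula are over `ℚ`, while the truncations are
`K`-modules. -/
instance (p : ℕ) : Module ℚ (W.Trunc p) := Module.compHom _ (algebraMap ℚ K)

instance (p : ℕ) : IsScalarTower ℚ K (W.Trunc p) where
  smul_assoc c x y := by
    rw [Algebra.smul_def, mul_smul]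
    rfl

/-- The operators on `A` modulo weight `p` that raise the weight by `k`. -/
def raising (p k : ℕ) : Submodule ℚ (Module.End K (W.Trunc p)) where
  carrier := {T | ∀ i, ∀ x ∈ W.fil i, ∃ y ∈ W.fil (i + k), T (W.trunc p x) = W.trunc p y}
  add_mem' {S T} hS hT i x hx := by
    obtain ⟨y, hy, h⟩ := hS i x hx
    obtain ⟨z, hz, h'⟩ := hT i x hx
    exact ⟨y + z, Submodule.add_mem _ hy hz, by rw [LinearMap.add_apply, h, h', map_add]⟩
  zero_mem' i x _ := ⟨0, Submodule.zero_mem _, by simp⟩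
  smul_mem' c T hT i x hx := by
    obtain ⟨y, hy, h⟩ := hT i x hx
    refine ⟨(c : K) • y, Submodule.smul_mem _ _ hy, ?_⟩
    rw [LinearMap.smul_apply, h, map_smul]
    rfl

theorem raising_mul_le (p k m : ℕ) : W.raising p k * W.raising p m ≤ W.raising p (k + m) := by
  rw [Submodule.mul_le]
  intro S hS T hT i x hx
  obtain ⟨y, hy, h⟩ := hT i x hx
  obtain ⟨z, hz, h'⟩ := hS _ y hy
  exact ⟨z, by rwa [add_assoc, add_comm m k] at hz, by rw [Module.End.mul_apply, h, h']⟩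

theorem raising_pow_le (p k : ℕ) : W.raising p 1 ^ k ≤ W.raising p k := by
  induction k with
  | zero =>
    rw [pow_zero, Submodule.one_le]
    exact fun i x hx => ⟨x, hx, rfl⟩
  | succ k ih =>
    rw [pow_succ]
    exact (mul_le_mul' ih le_rfl).trans (W.raising_mul_le p k 1)

theorem raising_one_mul_le (p : ℕ) : W.raising p 1 * W.raising p 1 ≤ W.raising p 1 := by
  refine (W.raising_mul_le p 1 1).trans fun T hT i x hx => ?_
  obtain ⟨y, hy, h⟩ := hT i x hx
  exact ⟨y, W.fil_antitone (by omega) hy, h⟩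

/-- Raising the weight `p` times lands in `W.fil p`, which is zero in the truncation. This is the
nilpotent algebra to which the associative formula applies. -/
theorem raising_one_pow (p : ℕ) : W.raising p 1 ^ p = ⊥ := by
  refine le_bot_iff.mp ((W.raising_pow_le p p).trans fun T hT => ?_)
  rw [Submodule.mem_bot]
  refine W.trunc_end_ext fun x => ?_
  obtain ⟨y, hy, h⟩ := hT 0 x (W.mem_fil_zero x)
  rw [zero_add] at hy
  rw [h, LinearMap.zero_apply]
  exact W.trunc_eq_zero_iff.mpr hy

variable {W}

theorem rho_mem_raising {p : ℕ} {l : A} (hl : l ∈ W.g 0) : W.rho p l ∈ W.raising p 1 := by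
  refine Submodule.neg_mem _ fun i x hx => ⟨_, W.star_mem_fil hx (W.mem_g.mp hl).2, rfl⟩

theorem rho_pow_eq_zero {p : ℕ} {l : A} (hl : l ∈ W.g 0) : W.rho p l ^ p = 0 := by
  have := Submodule.pow_mem_pow _ (rho_mem_raising (p := p) hl) p
  rwa [raising_one_pow, Submodule.mem_bot] at this

theorem isNilpotent_rho {p : ℕ} {l : A} (hl : l ∈ W.g 0) : IsNilpotent (W.rho p l) :=
  ⟨p, rho_pow_eq_zero hl⟩

theorem exp_neg_rho_trunc {p m : ℕ} {l : A} (hl : l ∈ W.g 0) (a : A) (hpm : p ≤ m) :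
    IsNilpotent.exp (-W.rho p l) (W.trunc p a) =
      W.trunc p (∑ n ∈ Finset.range m, (n.factorial : K)⁻¹ • ((P.star.flip l) ^ n) a) := by
  have h0 : (-W.rho p l) ^ m = 0 := by
    rw [neg_pow, pow_eq_zero_of_le hpm (rho_pow_eq_zero hl), mul_zero]
  have hpow : ∀ n, ((-W.rho p l) ^ n) (W.trunc p a) =
      W.trunc p (((P.star.flip l) ^ n) a) := by
    intro n
    induction n with
    | zero => rfl
    | succ n ih =>
      rw [pow_succ', Module.End.mul_apply, ih, pow_succ', rho_apply, neg_neg]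
      rfl
  rw [IsNilpotent.exp_eq_sum h0, LinearMap.sum_apply, map_sum]
  refine Finset.sum_congr rfl fun n _ => ?_
  rw [LinearMap.smul_apply, hpow, map_smul, inv_factorial_smul (K := K)]

theorem trunc_circ_exp {p : ℕ} {l : A} (hl : l ∈ W.g 0) (a : A) :
    W.trunc p (W.circ a (W.exp l)) = IsNilpotent.exp (-W.rho p l) (W.trunc p a) := by
  rw [exp_neg_rho_trunc hl a le_rfl, ← sub_eq_zero, ← map_sub, ← neg_eq_zero, ← map_neg, neg_sub]
  exact W.trunc_eq_zero_iff.mpr (sum_sub_circ_exp_mem_fil hl a le_rfl)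

theorem trunc_exp {p : ℕ} {l : A} (hl : l ∈ W.g 0) :
    W.trunc p (W.exp l) = IsNilpotent.exp (-W.rho p l) (W.trunc p P.one) := by
  rw [exp_neg_rho_trunc hl P.one le_rfl, ← sub_eq_zero, ← map_sub, ← neg_eq_zero, ← map_neg, neg_sub]
  refine W.trunc_eq_zero_iff.mpr ?_
  have := (expTerm_mem_evalRel hl).2 p
  simpa only [expTerm, starPow_eq_pow_apply] using this

theorem eq_of_exp_rho_eq {x y : A} (hx : x ∈ W.g 0) (hy : y ∈ W.g 0)
    (h : ∀ p, IsNilpotent.exp (W.rho p x) = IsNilpotent.exp (W.rho p y)) : x = y := by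
  refine eq_of_trunc_eq (W := W) fun p => ?_
  have h1 := congrArg (fun T : Module.End K (W.Trunc p) => T (W.trunc p P.one))
    (IsNilpotent.exp_injective (isNilpotent_rho hx) (isNilpotent_rho hy) (h p))
  simp only [rho_one] at h1
  exact neg_injective h1

/-- Conjugation is the exponential of the commutator with `rho l`, and that commutator corresponds
to `ad_l`. General `c` and `e` cover both the formal `δ` (`c = 1`) and an internal one (`c = 0`). -/
theorem exp_rho_conj_rightMulPlus {p : ℕ} {l : A} (hl : l ∈ W.g 0) {x : A} (hx : x ∈ P.deg (-1))
    (c : K) {y : A} {e : K}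
    (hy : ∀ᶠ m in Filter.atTop, (∑ n ∈ Finset.range m,
      (n.factorial : K)⁻¹ • (P.adPlus l)^[n] (x, c)).1 - y ∈ W.fil p)
    (he : ∀ᶠ m in Filter.atTop, (∑ n ∈ Finset.range m,
      (n.factorial : K)⁻¹ • (P.adPlus l)^[n] (x, c)).2 = e) :
    IsNilpotent.exp (W.rho p l) * W.toQuot p (W.rightMulPlus (x, c)) *
      IsNilpotent.exp (-W.rho p l) = W.toQuot p (W.rightMulPlus (y, e)) := by
  obtain ⟨q, hq⟩ := isNilpotent_commOp (isNilpotent_rho (p := p) hl)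
  obtain ⟨m, ⟨h1, h2⟩, hm⟩ := ((hy.and he).and (Filter.eventually_ge_atTop q)).exists
  rw [← exp_commOp_apply (isNilpotent_rho hl)]
  have h := exp_commOp_apply_eq_sum (pow_eq_zero_of_le hm hq)
    (T := fun n => W.toQuot p (W.rightMulPlus ((P.adPlus l)^[n] (x, c)))) (fun n => by
      rw [Function.iterate_succ_apply', commOp_apply, rho_apply]
      have hc := congrArg (W.toQuot p) (W.commutator_rightMul_rightMulPlus (W.mem_g.mp hl).1
        (v := (P.adPlus l)^[n] (x, c)) (adPlus_iterate_mem hl hx n))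
      rw [map_sub, map_mul, map_mul, map_neg] at hc
      rw [neg_mul, mul_neg, ← neg_sub', hc, neg_neg])
  refine h.trans ?_
  have hsum : ∀ v : ℕ → A × K, W.rightMulPlus (∑ n ∈ Finset.range m, (n.factorial : K)⁻¹ • v n) =
      ∑ n ∈ Finset.range m, (n.factorial : K)⁻¹ • W.rightMulPlus (v n) := by
    intro v
    let f : (A × K) →ₗ[K] W.filEnd :=
      { toFun := W.rightMulPlus
        map_add' := W.rightMulPlus_add
        map_smul' := W.rightMulPlus_smul }
    have := map_sum f (fun n => (n.factorial : K)⁻¹ • v n) (Finset.range m)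
    exact this.trans (Finset.sum_congr rfl fun n _ => map_smul f _ _)
  have h3 : ∑ n ∈ Finset.range m, (n.factorial : ℚ)⁻¹ •
      W.toQuot p (W.rightMulPlus ((P.adPlus l)^[n] (x, c))) =
      W.toQuot p (W.rightMulPlus (∑ n ∈ Finset.range m,
        (n.factorial : K)⁻¹ • (P.adPlus l)^[n] (x, c))) := by
    rw [hsum, map_sum]
    refine Finset.sum_congr rfl fun n _ => ?_
    rw [map_smul, inv_factorial_smul (K := K)]
  rw [h3, ← sub_eq_zero, ← map_sub]
  refine W.toQuot_eq_zero fun a => ?_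
  change (W.rightMulPlus _).1 a - (W.rightMulPlus _).1 a ∈ _
  rw [rightMulPlus_apply, rightMulPlus_apply, h2, sub_sub_sub_cancel_right, ← map_sub]
  simpa using W.star_mem_fil (W.mem_fil_zero a) h1

theorem exp_rho_conj_gauge {p : ℕ} {l α : A} (hl : l ∈ W.g 0) (hα : α ∈ W.g (-1)) :
    IsNilpotent.exp (W.rho p l) * W.toQuot p (W.rightMulPlus (α, 1)) *
      IsNilpotent.exp (-W.rho p l) = W.toQuot p (W.rightMulPlus (W.gauge l α, 1)) := by
  refine exp_rho_conj_rightMulPlus hl (W.mem_g.mp hα).1 1 ?_ ?_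
  · filter_upwards [Filter.eventually_ge_atTop p] with m hm
    have := W.sum_sub_mem_fil (expAdTerm_mem_evalRel hl hα).2 hm
    rw [Prod.fst_sum]
    exact this
  · filter_upwards [Filter.eventually_ge_atTop 1] with m hm
    rw [Prod.snd_sum]
    exact sum_expAdTerm_snd l α hm

/-- A conjugate of a square-zero operator squares to zero. -/
theorem gauge_mem_MC {l α : A} (hl : l ∈ W.g 0) (hα : α ∈ W.MC) : W.gauge l α ∈ W.MC := by
  obtain ⟨hα1, hα2⟩ := W.mem_MC_iff.mp hα
  refine W.mem_MC_iff.mpr ⟨(expAdTerm_mem_evalRel hl hα1).1, ?_⟩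
  refine eq_zero_of_toQuot_eq_zero fun p => ?_
  rw [map_mul, ← exp_rho_conj_gauge hl hα1]
  have h1 := IsNilpotent.exp_neg_mul_exp_self (isNilpotent_rho (p := p) hl)
  have h2 := congrArg (W.toQuot p) hα2
  rw [map_mul, map_zero] at h2
  set e := IsNilpotent.exp (W.rho p l)
  set e' := IsNilpotent.exp (-W.rho p l)
  set T := W.toQuot p (W.rightMulPlus (α, 1))
  calc e * T * e' * (e * T * e') = e * T * (e' * e) * T * e' := by simp only [mul_assoc]
    _ = e * (T * T) * e' := by rw [h1, mul_one, mul_assoc e T T]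
    _ = 0 := by rw [h2, mul_zero, zero_mul]

/-- Apply the conjugated operator to the left unit: the right factor gives `e^l`, the middle one
multiplies by `α` and subtracts `d`, and the left factor is the circle product with `e^{-l}`. -/
theorem circ_star_exp_sub_d_exp {l α : A} (hl : l ∈ W.g 0) (hα : α ∈ W.g (-1)) :
    W.circ (P.star (W.exp l) α - P.d (W.exp l)) (W.exp (-l)) = W.gauge l α := by
  refine eq_of_trunc_eq (W := W) fun p => ?_
  rw [trunc_circ_exp (Submodule.neg_mem _ hl), map_neg, neg_neg,
    ← toQuot_rightMulPlus_one p (W.gauge l α) (1 : K), ← exp_rho_conj_gauge hl hα,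
    Module.End.mul_apply, Module.End.mul_apply, ← trunc_exp hl, toQuot_apply_trunc, rightMulPlus_apply,
    signedD_apply (exp_mem_deg hl)]
  simp

end CharZero

end DGPreLie.WeightGrading

/-! ### The BCH group, its action, the flow and the internal case -/

namespace DGPreLie.WeightGrading

variable {K : Type*} {A : Type*} [Field K] [AddCommGroup A] [Module K A] {P : DGPreLie K A}
  {W : P.WeightGrading}

theorem bchTerm_mem_deg {x y : A} (hx : x ∈ P.deg 0) (hy : y ∈ P.deg 0) (N : ℕ) :
    P.bchTerm x y N ∈ P.deg 0 := by
  refine Submodule.sum_mem _ fun n _ => Submodule.sum_mem _ fun rs _ =>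
    Submodule.smul_mem _ _ (nestedBracket_mem_deg fun a ha => ?_)
  rcases mem_bchWord ha with rfl | rfl
  · exact hx
  · exact hy

theorem bchTerm_mem_fil {x y : A} (hx : x ∈ W.fil 1) (hy : y ∈ W.fil 1) (N : ℕ) :
    P.bchTerm x y N ∈ W.fil N := by
  refine Submodule.sum_mem _ fun n _ => Submodule.sum_mem _ fun rs hrs =>
    Submodule.smul_mem _ _ ?_
  rw [← (Finset.mem_filter.mp hrs).2.2, ← length_bchWord x y rs]
  refine W.nestedBracket_mem_fil fun a ha => ?_
  rcases mem_bchWord ha with rfl | rfl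
  · exact hx
  · exact hy

theorem bchTerm_mem_evalRel {x y : A} (hx : x ∈ W.g 0) (hy : y ∈ W.g 0) :
    W.bch x y ∈ W.g 0 ∧ (P.bchTerm x y, W.bch x y) ∈ evalRel W.fil := by
  obtain ⟨hx0, hx1⟩ := W.mem_g.mp hx
  obtain ⟨hy0, hy1⟩ := W.mem_g.mp hy
  obtain ⟨z, hz0, hz⟩ := W.exists_mem_evalRel (bchTerm_mem_deg hx0 hy0) (bchTerm_mem_fil hx1 hy1)
  rw [bch, W.wsum_eq_of_mem_evalRel hz]
  refine ⟨W.mem_g.mpr ⟨hz0, ?_⟩, hz⟩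
  have h := hz.2 1
  simp only [Finset.sum_range_one] at h
  rw [show P.bchTerm x y 0 = 0 by simp [bchTerm], zero_sub] at h
  simpa using Submodule.neg_mem _ h

theorem pow_smul_expAdTerm (t : K) (l α : A) (n : ℕ) :
    t ^ n • expAdTerm P l α n = expAdTerm P (t • l) α n := by
  have h : (P.adPlus (t • l))^[n] (α, 1) = t ^ n • (P.adPlus l)^[n] (α, 1) := by
    induction n with
    | zero => simp
    | succ n ih =>
      rw [Function.iterate_succ_apply', ih, adPlus_smul, adPlus_smul_left, smul_smul, ← pow_succ,
        Function.iterate_succ_apply']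
  rw [expAdTerm, expAdTerm, h, smul_comm]

theorem hasWSumPlus_expAdTerm {l α : A} (hl : l ∈ W.g 0) (hα : α ∈ W.g (-1)) :
    W.HasWSumPlus (expAdTerm P l α) (W.gauge l α, 1) := by
  refine ⟨W.hasWSum_of_mem_evalRel (expAdTerm_mem_evalRel hl hα).2, ?_⟩
  filter_upwards [Filter.eventually_ge_atTop 1] with m hm
  exact sum_expAdTerm_snd l α hm

theorem adPlus_iterate_zero_snd (l x : A) (n : ℕ) :
    (P.adPlus l)^[n] (x, 0) = ((P.bracket 0 (-1) l)^[n] x, 0) := by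
  induction n with
  | zero => rfl
  | succ n ih =>
    rw [Function.iterate_succ_apply', Function.iterate_succ_apply', ih, adPlus_apply, zero_smul,
      sub_zero]

theorem bracket_swap_deg_neg_one (x y : A) : P.bracket 0 (-1) x y = -P.bracket (-1) 0 y x := by
  simp [bracket]

/-- An internal and a formal `δ` become indistinguishable after one bracket with `l`, since both
give `-dl`. -/
theorem bracket_iterate_add {δ l : A} (hδ : P.bracket (-1) 0 δ l = P.d l) (α : A) (n : ℕ) :
    (P.bracket 0 (-1) l)^[n + 1] (δ + α) = ((P.adPlus l)^[n + 1] (α, 1)).1 := by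
  have h : P.adPlus l (α, 1) = (P.bracket 0 (-1) l (δ + α), 0) := by
    have h1 : P.bracket 0 (-1) l (δ + α) = P.bracket 0 (-1) l δ + P.bracket 0 (-1) l α := by
      simp only [bracket, map_add, LinearMap.add_apply, smul_add]
      abel
    rw [adPlus_apply, h1, bracket_swap_deg_neg_one l δ, hδ, one_smul]
    congr 1
    abel
  rw [Function.iterate_succ_apply, Function.iterate_succ_apply, h, adPlus_iterate_zero_snd]

theorem internal_mem_evalRel {δ l α : A} (hδ : P.bracket (-1) 0 δ l = P.d l) (hl : l ∈ W.g 0)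
    (hα : α ∈ W.g (-1)) :
    ((fun n => (n.factorial : K)⁻¹ • (P.bracket 0 (-1) l)^[n] (δ + α)), δ + W.gauge l α) ∈
      evalRel W.fil := by
  have h1 : ((Pi.single 0 δ : ℕ → A), δ) ∈ evalRel W.fil := by
    refine ⟨fun n => ?_, fun n => ?_⟩ <;> rcases n with _ | n
    · exact W.mem_fil_zero _
    · simp
    · exact W.mem_fil_zero _
    · simp
  convert AddSubgroup.add_mem _ h1 (expAdTerm_mem_evalRel hl hα).2 using 1
  rw [Prod.mk_add_mk]
  congr 1
  funext n
  rcases n with _ | n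
  · simp [expAdTerm]
  · rw [bracket_iterate_add hδ]
    simp [expAdTerm]

theorem rho_eq_zero {p : ℕ} {l : A} (hl : l ∈ W.fil p) : W.rho p l = 0 := by
  rw [rho_apply, W.toQuot_eq_zero, neg_zero]
  intro a
  rw [rightMul_apply]
  simpa using W.star_mem_fil (W.mem_fil_zero a) hl

section CharZero

variable [CharZero K]

theorem rho_bchTerm {p : ℕ} {x y : A} (hx : x ∈ P.deg 0) (hy : y ∈ P.deg 0) (N : ℕ) :
    W.rho p (P.bchTerm x y N) = bchComm (W.rho p x) (W.rho p y) N := by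
  rw [bchTerm, bchComm, map_sum]
  refine Finset.sum_congr rfl fun n _ => ?_
  rw [map_sum]
  refine Finset.sum_congr rfl fun rs _ => ?_
  rw [map_smul, ← map_bchWord, ← Rat.cast_smul_eq_qsmul K]
  congr 1
  · push_cast
    rfl
  · refine rho_nestedBracket fun a ha => ?_
    rcases mem_bchWord ha with rfl | rfl
    · exact hx
    · exact hy

/-- The associative formula, transported by `rho`; the tail of the BCH series has weight at least
`p` and acts by zero. -/
theorem exp_rho_mul_exp_rho {p : ℕ} {x y : A} (hx : x ∈ W.g 0) (hy : y ∈ W.g 0) :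
    IsNilpotent.exp (W.rho p x) * IsNilpotent.exp (W.rho p y) =
      IsNilpotent.exp (W.rho p (W.bch x y)) := by
  rw [exp_mul_exp_eq_exp_sum_bchComm (W.raising_one_mul_le p) (W.raising_one_pow p)
    (rho_mem_raising hx) (rho_mem_raising hy)]
  congr 1
  rw [← sub_eq_zero, ← rho_eq_zero ((bchTerm_mem_evalRel hx hy).2.2 p), map_sub, map_sum]
  congr 1
  exact Finset.sum_congr rfl fun N _ =>
    (rho_bchTerm (W.mem_g.mp hx).1 (W.mem_g.mp hy).1 N).symm

/-- Associativity of operator composition, pulled back along the faithful family `l ↦ exp (rho l)`.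
-/
theorem bch_assoc {x y z : A} (hx : x ∈ W.g 0) (hy : y ∈ W.g 0) (hz : z ∈ W.g 0) :
    W.bch (W.bch x y) z = W.bch x (W.bch y z) := by
  have hxy := (bchTerm_mem_evalRel hx hy).1
  have hyz := (bchTerm_mem_evalRel hy hz).1
  refine eq_of_exp_rho_eq (bchTerm_mem_evalRel hxy hz).1 (bchTerm_mem_evalRel hx hyz).1
    fun p => ?_
  rw [← exp_rho_mul_exp_rho hxy hz, ← exp_rho_mul_exp_rho hx hyz, ← exp_rho_mul_exp_rho hx hy,
    ← exp_rho_mul_exp_rho hy hz, mul_assoc]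

theorem zero_bch {x : A} (hx : x ∈ W.g 0) : W.bch 0 x = x := by
  refine eq_of_exp_rho_eq (bchTerm_mem_evalRel (W.g 0).zero_mem hx).1 hx fun p => ?_
  rw [← exp_rho_mul_exp_rho (W.g 0).zero_mem hx, map_zero, IsNilpotent.exp_zero, one_mul]

theorem bch_zero {x : A} (hx : x ∈ W.g 0) : W.bch x 0 = x := by
  refine eq_of_exp_rho_eq (bchTerm_mem_evalRel hx (W.g 0).zero_mem).1 hx fun p => ?_
  rw [← exp_rho_mul_exp_rho hx (W.g 0).zero_mem, map_zero, IsNilpotent.exp_zero, mul_one]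

theorem neg_bch_self {x : A} (hx : x ∈ W.g 0) : W.bch (-x) x = 0 := by
  have hx' := (W.g 0).neg_mem hx
  refine eq_of_exp_rho_eq (bchTerm_mem_evalRel hx' hx).1 (W.g 0).zero_mem fun p => ?_
  rw [← exp_rho_mul_exp_rho hx' hx, map_neg, map_zero, IsNilpotent.exp_zero,
    IsNilpotent.exp_neg_mul_exp_self (isNilpotent_rho hx)]

variable (W) in
/-- The gauge group `(g₀, BCH, 0)`. -/
noncomputable abbrev gaugeGroup : Group (W.g 0) where
  mul x y := ⟨W.bch x y, (bchTerm_mem_evalRel x.2 y.2).1⟩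
  one := 0
  inv x := -x
  mul_assoc x y z := Subtype.ext (bch_assoc x.2 y.2 z.2)
  one_mul x := Subtype.ext (zero_bch x.2)
  mul_one x := Subtype.ext (bch_zero x.2)
  inv_mul_cancel x := Subtype.ext (neg_bch_self x.2)

theorem gauge_zero {α : A} (hα : α ∈ W.g (-1)) : W.gauge 0 α = α := by
  refine (eq_of_toQuot_rightMulPlus_eq (W := W) (c := 1) (e := 1) fun p => ?_).symm
  rw [← exp_rho_conj_gauge (W.g 0).zero_mem hα, map_zero, neg_zero, IsNilpotent.exp_zero, one_mul,
    mul_one]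

/-- Successive conjugations compose, and `e^{rho x} e^{rho y}` is the exponential of the BCH
product. -/
theorem gauge_bch {x y α : A} (hx : x ∈ W.g 0) (hy : y ∈ W.g 0) (hα : α ∈ W.g (-1)) :
    W.gauge (W.bch x y) α = W.gauge x (W.gauge y α) := by
  refine eq_of_toQuot_rightMulPlus_eq (W := W) (c := 1) (e := 1) fun p => ?_
  have hxy := (bchTerm_mem_evalRel hx hy).1
  have hinv : IsNilpotent.exp (-W.rho p (W.bch x y)) =
      IsNilpotent.exp (-W.rho p y) * IsNilpotent.exp (-W.rho p x) := by
    refine left_inv_eq_right_inv (IsNilpotent.exp_neg_mul_exp_self (isNilpotent_rho hxy)) ?_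
    rw [← exp_rho_mul_exp_rho hx hy, mul_assoc, ← mul_assoc (IsNilpotent.exp (W.rho p y)),
      IsNilpotent.exp_mul_exp_neg_self (isNilpotent_rho hy), one_mul,
      IsNilpotent.exp_mul_exp_neg_self (isNilpotent_rho hx)]
  rw [← exp_rho_conj_gauge hxy hα, ← exp_rho_conj_gauge hx (expAdTerm_mem_evalRel hy hα).1,
    ← exp_rho_conj_gauge hy hα, hinv, ← exp_rho_mul_exp_rho hx hy]
  simp only [mul_assoc]

theorem smul_expAdTerm_succ (l α : A) (n : ℕ) :
    ((n : K) + 1) • expAdTerm P l α (n + 1) = P.adPlus l (expAdTerm P l α n) := by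
  have h : (n : K) + 1 ≠ 0 := by exact_mod_cast n.succ_ne_zero
  rw [expAdTerm, expAdTerm, adPlus_smul, Function.iterate_succ_apply', smul_smul]
  congr 1
  rw [Nat.factorial_succ]
  push_cast
  rw [mul_inv, ← mul_assoc, mul_inv_cancel₀ h, one_mul]

theorem isIntegralCurve_expAdTerm {l α : A} (hl : l ∈ W.g 0) (hα : α ∈ W.g (-1)) :
    W.IsIntegralCurve l α (expAdTerm P l α) := by
  refine ⟨fun n => ?_, by simp [expAdTerm], smul_expAdTerm_succ l α⟩
  refine Submodule.smul_mem _ _ (W.mem_g.mpr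
    ⟨adPlus_iterate_mem hl (W.mem_g.mp hα).1 n, ?_⟩)
  rcases n with _ | n
  · exact (W.mem_g.mp hα).2
  · exact W.fil_antitone (by omega) (adPlus_iterate_mem_fil hl _ (n + 1))

/-- The equation is a recursion for the coefficients, solvable because `n + 1` is invertible. -/
theorem IsIntegralCurve.unique {l α : A} {γ γ' : ℕ → A × K} (h : W.IsIntegralCurve l α γ)
    (h' : W.IsIntegralCurve l α γ') : γ = γ' := by
  funext n
  induction n with
  | zero => rw [h.2.1, h'.2.1]
  | succ n ih =>
    have hn : (n : K) + 1 ≠ 0 := by exact_mod_cast n.succ_ne_zero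
    have := (h.2.2 n).trans ((congrArg _ ih).trans (h'.2.2 n).symm)
    exact smul_right_injective _ hn this

/-- The same evaluation at the left unit, with `δ + α` a genuine element: `c = 0`, so no
differential term appears. -/
theorem circ_star_exp_internal {δ l α : A} (hδ0 : δ ∈ P.deg (-1))
    (hδ : P.bracket (-1) 0 δ l = P.d l) (hl : l ∈ W.g 0) (hα : α ∈ W.g (-1)) :
    W.circ (P.star (W.exp l) (δ + α)) (W.exp (-l)) = δ + W.gauge l α := by
  refine eq_of_trunc_eq (W := W) fun p => ?_
  have h := exp_rho_conj_rightMulPlus (W := W) (p := p) hl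
    (Submodule.add_mem _ hδ0 (W.mem_g.mp hα).1) 0 (y := δ + W.gauge l α) (e := 0) (by
      filter_upwards [Filter.eventually_ge_atTop p] with m hm
      have := W.sum_sub_mem_fil (internal_mem_evalRel hδ hl hα) hm
      rw [Prod.fst_sum]
      simpa only [adPlus_iterate_zero_snd, Prod.smul_fst] using this)
    (Filter.Eventually.of_forall fun m => by
      rw [Prod.snd_sum]
      simp [adPlus_iterate_zero_snd])
  rw [trunc_circ_exp (Submodule.neg_mem _ hl), map_neg, neg_neg,
    ← toQuot_rightMulPlus_one p (δ + W.gauge l α) (0 : K), ← h,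
    Module.End.mul_apply, Module.End.mul_apply, ← trunc_exp hl, toQuot_apply_trunc,
    rightMulPlus_apply, zero_smul, sub_zero]

variable (W) in
/-- The action of the gauge group on the Maurer-Cartan elements. -/
noncomputable abbrev gaugeAction : @MulAction (W.g 0) W.MC W.gaugeGroup.toMonoid :=
  letI := W.gaugeGroup
  { smul := fun l α => ⟨W.gauge l α, gauge_mem_MC l.2 α.2⟩
    one_smul := fun α => Subtype.ext (gauge_zero α.2.1)
    mul_smul := fun x y α => Subtype.ext (gauge_bch x.2 y.2 α.2.1) }

end CharZero

end DGPreLie.WeightGrading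

/-! ### Assembly -/

theorem mainTheorem3 {K : Type u} {A : Type v} [Field K] [CharZero K] [AddCommGroup A]
    [Module K A] (P : DGPreLie K A) (W : P.WeightGrading) :
    -- all series that occur converge
    (∀ l ∈ W.g 0, W.HasWSum (DGPreLie.WeightGrading.expTerm P l) (W.exp l)) ∧
    (∀ l ∈ W.g 0, ∀ a : A,
      W.HasWSum (DGPreLie.WeightGrading.circTerm P a (W.exp l)) (W.circ a (W.exp l))) ∧
    (∀ x ∈ W.g 0, ∀ y ∈ W.g 0, W.HasWSum (P.bchTerm x y) (W.bch x y)) ∧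
    -- the infinitesimal action has a unique flow, which is defined at all times, so at `t = 1`
    (∀ l ∈ W.g 0, ∀ α ∈ W.MC, ∃ γ : ℕ → A × K,
      W.IsIntegralCurve l α γ ∧ (∀ γ', W.IsIntegralCurve l α γ' → γ' = γ) ∧
      (∀ t : K, W.HasWSumPlus (fun n => t ^ n • γ n) (W.gauge (t • l) α, 1)) ∧
      γ = DGPreLie.WeightGrading.expAdTerm P l α) ∧
    -- the flow at `t = 1` is an action of the gauge group `(g₀, BCH, 0)`
    (∃ (_ : Group (W.g 0)) (_ : MulAction (W.g 0) W.MC),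
      (∀ x y : W.g 0, ((x * y : W.g 0) : A) = W.bch x y) ∧
      (1 : W.g 0) = 0 ∧
      (∀ (l : W.g 0) (α : W.MC), ((l • α : W.MC) : A) = W.gauge l α)) ∧
    -- the formula for the action, when the differential is not assumed to be internal to `A`
    (∀ l ∈ W.g 0, ∀ α ∈ W.MC,
      W.gauge l α = W.circ (P.star (W.exp l) α - P.d (W.exp l)) (W.exp (-l))) ∧
    -- the formula for the action, when the differential is `[δ, -]` for an element `δ` of `A`
    (∀ δ ∈ P.deg (-1), (∀ k : ℤ, ∀ x ∈ W.g k, P.bracket (-1) k δ x = P.d x) →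
      ∀ l ∈ W.g 0, ∀ α ∈ W.MC,
        W.HasWSum (fun n => (n.factorial : K)⁻¹ • (P.bracket 0 (-1) l)^[n] (δ + α))
          (δ + W.gauge l α) ∧
        δ + W.gauge l α = W.circ (P.star (W.exp l) (δ + α)) (W.exp (-l))) := by
  refine ⟨fun l hl => W.hasWSum_of_mem_evalRel
      (DGPreLie.WeightGrading.expTerm_mem_evalRel hl),
    fun l hl a => W.hasWSum_of_mem_evalRel (DGPreLie.WeightGrading.circTerm_mem_evalRel a
      (DGPreLie.WeightGrading.exp_sub_one_mem_g hl)),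
    fun x hx y hy => W.hasWSum_of_mem_evalRel
      (DGPreLie.WeightGrading.bchTerm_mem_evalRel hx hy).2,
    fun l hl α hα => ?_, ⟨W.gaugeGroup, W.gaugeAction, fun _ _ => rfl, rfl, fun _ _ => rfl⟩,
    fun l hl α hα => (DGPreLie.WeightGrading.circ_star_exp_sub_d_exp hl hα.1).symm,
    fun δ hδ0 hδ l hl α hα => ?_⟩
  · have hγ := DGPreLie.WeightGrading.isIntegralCurve_expAdTerm hl hα.1
    refine ⟨_, hγ, fun γ' h => h.unique hγ, fun t => ?_, rfl⟩
    simp only [DGPreLie.WeightGrading.pow_smul_expAdTerm]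
    exact DGPreLie.WeightGrading.hasWSumPlus_expAdTerm (Submodule.smul_mem _ t hl) hα.1
  · exact ⟨W.hasWSum_of_mem_evalRel
        (DGPreLie.WeightGrading.internal_mem_evalRel (hδ 0 l hl) hl hα.1),
      (DGPreLie.WeightGrading.circ_star_exp_internal hδ0 (hδ 0 l hl) hl hα.1).symm⟩
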